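/- For each $n$ let $X=X_n$ be a real $n\times p$ matrix ($p=p_n$) of rank $R=R_n$ such that $X_S^TX_S$ is nonsingular for every $S\subseteq\{1,\dots,p\}$ with $|S|\le R$, where $X_S$ consists of the columns of $X$ with index in $S$. Let the data be $y\sim N_n(X\beta^\star,\sigma_0^2I_n)$, where $\sigma_0=\sigma_{0,n}>0$ satisfies $0<d_1<\sigma_0^2<d_2<\infty$ with $d_1,d_2$ not depending on $n$. Write $E_{\beta^\star}$ for expectation under this law, $S^\star=\{j:\beta^\star_j\ne0\}$, $s^\star=|S^\star|$, and $\hat\beta_S=(X_S^TX_S)^{-1}X_S^Ty$. Fix constants $0<\alpha<1$ and $\gamma,a_0,b_0,a,c>0$. The empirical prior $\Pi_n$ of $(\beta,\sigma^2)$ is the mixture over $S\subseteq\{1,\dots,p\}$, with weights $\pi(S)=\binom{p}{|S|}^{-1}f_n(|S|)$, where $f_n(s)\propto(cp^a)^{-s}$ for $s=0,\dots,R$ and $f_n(s)=0$ for $s>R$, of the following laws: $\sigma^2$ is inverse gamma with shape $a_0$ and scale $b_0$; given $\sigma^2$, $\beta_S\sim N_{|S|}(\hat\beta_S,\sigma^2\gamma^{-1}(X_S^TX_S)^{-1})$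 and $\beta_{S^c}=0$. With the fractional likelihood $L^\alpha(\beta,\sigma^2)=(2\pi\sigma^2)^{-n\alpha/2}\exp(-\frac{\alpha}{2\sigma^2}\|y-X\beta\|^2)$, the empirical Bayes posterior of $\beta$ is $$\Pi^n(B)=\frac{\int_B\int_{\sigma^2>0} L^\alpha(\beta,\sigma^2)\,\Pi_n(d\beta,d\sigma^2)}{\int_{\mathbb R^p}\int_{\sigma^2>0} L^\alpha(\beta,\sigma^2)\,\Pi_n(d\beta,d\sigma^2)},$$ and $\pi^n(S)$ denotes the corresponding posterior probability of the model $S$, that is, the contribution of the $S$-th mixture component to the denominator, divided by the denominator. Let $B_n\subseteq\mathbb R^{p_n}$ be sets such that, uniformly in $\beta^\star\in B_n$ as $n\to\infty$, $s^\star=o(\sqrt n/\log n)$ and $E_{\beta^\star}\pi^n(S^\star)\to1$. Then, uniformly in $\beta^\star\in B_n$ as $n\to\infty$, $$E_{\beta^\star}H^2\Big(\Pi^n,\;N_{s^\star}\big(\hat\beta_{S^\star},\tfrac{\sigma_0^2}{\alpha+\gamma}(X_{S^\star}^TX_{S^\star})^{-1}\big)\otimes\delta_0\Big)\to0$$ and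 $$E_{\beta^\star}d_{TV}\Big(\Pi^n,\;N_{s^\star}\big(\hat\beta_{S^\star},\tfrac{\sigma_0^2}{\alpha+\gamma}(X_{S^\star}^TX_{S^\star})^{-1}\big)\otimes\delta_0\Big)\to0,$$ where $\delta_0$ is the point mass at the origin for the coordinates in $(S^\star)^c$, $H^2(P,Q)=\int(\sqrt{dP}-\sqrt{dQ})^2$, and $d_{TV}(P,Q)=\sup_A|P(A)-Q(A)|$. -/

import Mathlib

open MeasureTheory ProbabilityTheory Filter
open scoped ENNReal Matrix

noncomputable section

namespace EmpiricalBayes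

/-- Tuning constants: fractional power `α`, prior precision factor `γ`, inverse gamma parameters
`a₀`, `b₀`, and the constants `a`, `c` in the prior on the model size. -/
structure HyperParams where
  α : ℝ
  γ : ℝ
  a₀ : ℝ
  b₀ : ℝ
  a : ℝ
  c : ℝ

/-- The admissible range of the tuning constants. -/
structure HyperParams.Admissible (h : HyperParams) : Prop where
  α_pos : 0 < h.α
  α_lt_one : h.α < 1
  γ_pos : 0 < h.γ
  a₀_pos : 0 < h.a₀
  b₀_pos : 0 < h.b₀
  a_pos : 0 < h.a
  c_pos : 0 < h.c

variable {n p : ℕ}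

/-- `X_S`, the columns of `X` with index in `S`. -/
def subDesign (X : Matrix (Fin n) (Fin p) ℝ) (S : Finset (Fin p)) : Matrix (Fin n) S ℝ :=
  X.submatrix id (fun j => (j : Fin p))

/-- `X_Sᵀ X_S`. -/
def gram (X : Matrix (Fin n) (Fin p) ℝ) (S : Finset (Fin p)) : Matrix S S ℝ :=
  (subDesign X S)ᵀ * subDesign X S

/-- The least squares estimator `(X_Sᵀ X_S)⁻¹ X_Sᵀ y`. -/
def leastSquares (X : Matrix (Fin n) (Fin p) ℝ) (y : EuclideanSpace ℝ (Fin n))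
    (S : Finset (Fin p)) : EuclideanSpace ℝ S :=
  WithLp.toLp 2 ((gram X S)⁻¹ *ᵥ ((subDesign X S)ᵀ *ᵥ y.ofLp))

/-- The vector of `ℝᵖ` with coordinates `b` on `S` and `0` off `S`. -/
def extendZero (S : Finset (Fin p)) (b : EuclideanSpace ℝ S) : EuclideanSpace ℝ (Fin p) :=
  WithLp.toLp 2 (fun j => if hj : j ∈ S then b ⟨j, hj⟩ else 0)

/-- `S_β = {j : β_j ≠ 0}`. -/
def support (β : EuclideanSpace ℝ (Fin p)) : Finset (Fin p) :=
  Finset.univ.filter (fun j => β j ≠ 0)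

/-- The law `N_{|S|}(β̂_S, v (X_Sᵀ X_S)⁻¹) ⊗ δ₀` on `ℝᵖ`, where `δ₀` is the point mass at the
origin for the coordinates off `S`. -/
def normalDirac (X : Matrix (Fin n) (Fin p) ℝ) (y : EuclideanSpace ℝ (Fin n))
    (S : Finset (Fin p)) (v : ℝ) : Measure (EuclideanSpace ℝ (Fin p)) :=
  (multivariateGaussian (leastSquares X y S) (v • (gram X S)⁻¹)).map (extendZero S)

/-- The inverse gamma distribution with shape `a₀` and scale `b₀`. -/
def invGamma (a₀ b₀ : ℝ) : Measure ℝ :=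
  volume.withDensity (fun v => ENNReal.ofReal
    (if 0 < v then Real.exp (-b₀ / v) * v ^ (-a₀ - 1) * b₀ ^ a₀ / Real.Gamma a₀ else 0))

/-- The prior of `(β, σ²)` given the model `S`: `σ² ∼ IG(a₀, b₀)`, and given `σ²`, `β_S` is
`N(β̂_S, σ² γ⁻¹ (X_Sᵀ X_S)⁻¹)` and `β` vanishes off `S`. -/
def priorGiven (h : HyperParams) (X : Matrix (Fin n) (Fin p) ℝ) (y : EuclideanSpace ℝ (Fin n))
    (S : Finset (Fin p)) : Measure (EuclideanSpace ℝ (Fin p) × ℝ) :=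
  (invGamma h.a₀ h.b₀).bind
    (fun v => (normalDirac X y S (v * h.γ⁻¹)).map (fun β => (β, v)))

section
open scoped MatrixOrder

/-- The kernel from `σ²` to the law of `(β, σ²)` used in `priorGiven` is measurable, so the mixture
over `σ²` is a genuine one. -/
theorem aemeasurable_conditional (h : HyperParams)
    (hγ : 0 < h.γ) (X : Matrix (Fin n) (Fin p) ℝ) (y : EuclideanSpace ℝ (Fin n))
    (S : Finset (Fin p)) :
    AEMeasurable (fun v : ℝ => (normalDirac X y S (v * h.γ⁻¹)).map
      (fun β => (β, v))) (invGamma h.a₀ h.b₀) := by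
  have hext : Measurable (extendZero S) := by
    unfold extendZero
    refine (WithLp.measurable_toLp 2 _).comp (measurable_pi_lambda _ fun j => ?_)
    by_cases hj : j ∈ S
    · simp only [hj, dif_pos]; fun_prop
    · simp only [hj, dif_neg, not_false_eq_true]; fun_prop
  have hA : ((gram X S)⁻¹).PosSemidef := by
    refine Matrix.PosSemidef.inv ?_
    have := Matrix.posSemidef_conjTranspose_mul_self (subDesign X S)
    rwa [Matrix.conjTranspose_eq_transpose_of_trivial] at this
  set A := (gram X S)⁻¹
  have hsqrt : ∀ v : ℝ, 0 ≤ v → CFC.sqrt (v • A) = √v • CFC.sqrt A := by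
    intro v hv
    refine CFC.sqrt_unique ?_ (smul_nonneg (Real.sqrt_nonneg v) (CFC.sqrt_nonneg A))
    rw [smul_mul_smul_comm, Real.mul_self_sqrt hv, CFC.sqrt_mul_sqrt_self _ hA.nonneg]
  let T := Matrix.toEuclideanCLM (𝕜 := ℝ) (CFC.sqrt A)
  let g : ℝ × EuclideanSpace ℝ S → EuclideanSpace ℝ (Fin p) × ℝ := fun q =>
    (extendZero S
      (leastSquares X y S + √(q.1 * h.γ⁻¹) • T q.2), q.1)
  have hg : Measurable g := by
    refine Measurable.prodMk (hext.comp ?_) measurable_fst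
    have : Measurable T := T.continuous.measurable
    fun_prop
  refine ⟨fun v => ((stdGaussian (EuclideanSpace ℝ S)).map (Prod.mk v)).map g,
    (Measure.measurable_map _ hg).comp Measurable.map_prodMk_left, ?_⟩
  have hpos : ∀ᵐ v ∂(invGamma h.a₀ h.b₀), 0 < v := by
    rw [invGamma, ae_withDensity_iff]
    · refine Eventually.of_forall fun v hv => ?_
      by_contra hcon
      simp [hcon] at hv
    · refine ENNReal.measurable_ofReal.comp (Measurable.ite measurableSet_Ioi ?_ measurable_const)
      fun_prop
  filter_upwards [hpos] with v hv
  have hv' : 0 ≤ v * h.γ⁻¹ := by positivity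
  rw [normalDirac, multivariateGaussian, hsqrt _ hv',
    Measure.map_map hext (by fun_prop), Measure.map_map (by fun_prop) (hext.comp (by fun_prop)),
    Measure.map_map hg (by fun_prop)]
  congr 1
  ext z <;> simp [g, T]

end

/-- The prior probability `f_n(s) ∝ (c pᵃ)^{-s}`, `0 ≤ s ≤ R`, of model size `s`, where `R` is the
rank of `X`. -/
def sizePrior (h : HyperParams) (X : Matrix (Fin n) (Fin p) ℝ) (s : ℕ) : ℝ :=
  if s ≤ X.rank then
    ((h.c * (p : ℝ) ^ h.a) ^ s)⁻¹ /
      ∑ t ∈ Finset.range (X.rank + 1), ((h.c * (p : ℝ) ^ h.a) ^ t)⁻¹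
  else 0

/-- The prior probability `π(S) = (p choose |S|)⁻¹ f_n(|S|)` of the model `S`. -/
def modelPrior (h : HyperParams) (X : Matrix (Fin n) (Fin p) ℝ) (S : Finset (Fin p)) : ℝ :=
  ((p.choose S.card : ℕ) : ℝ)⁻¹ * sizePrior h X S.card

/-- The empirical joint prior `Π_n` of `(β, σ²)`. -/
def jointPrior (h : HyperParams) (X : Matrix (Fin n) (Fin p) ℝ) (y : EuclideanSpace ℝ (Fin n)) :
    Measure (EuclideanSpace ℝ (Fin p) × ℝ) :=
  ∑ S : Finset (Fin p), ENNReal.ofReal (modelPrior h X S) • priorGiven h X y S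

/-- The fractional likelihood `L^α(β, σ²)`. -/
def fracLik (h : HyperParams) (X : Matrix (Fin n) (Fin p) ℝ) (y : EuclideanSpace ℝ (Fin n))
    (θ : EuclideanSpace ℝ (Fin p) × ℝ) : ℝ≥0∞ :=
  ENNReal.ofReal ((2 * Real.pi * θ.2) ^ (-((n : ℝ) * h.α / 2)) *
    Real.exp (-(h.α / (2 * θ.2)) * ‖y - WithLp.toLp 2 (X *ᵥ θ.1.ofLp)‖ ^ 2))

/-- The normalizing constant `∫∫ L^α dΠ_n` of the posterior. -/
def evidence (h : HyperParams) (X : Matrix (Fin n) (Fin p) ℝ) (y : EuclideanSpace ℝ (Fin n)) :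
    ℝ≥0∞ :=
  ∫⁻ θ, fracLik h X y θ ∂(jointPrior h X y)

/-- The empirical Bayes posterior `Π^n` of `β`:
`Π^n(B) = ∫_B ∫ L^α(β, σ²) Π_n(dβ, dσ²) / ∫ ∫ L^α(β, σ²) Π_n(dβ, dσ²)`. -/
def betaPosterior (h : HyperParams) (X : Matrix (Fin n) (Fin p) ℝ)
    (y : EuclideanSpace ℝ (Fin n)) : Measure (EuclideanSpace ℝ (Fin p)) :=
  (evidence h X y)⁻¹ • ((jointPrior h X y).withDensity (fracLik h X y)).map Prod.fst

/-- The marginal posterior probability `π^n(S)` of the model `S`. -/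
def modelPosterior (h : HyperParams) (X : Matrix (Fin n) (Fin p) ℝ)
    (y : EuclideanSpace ℝ (Fin n)) (S : Finset (Fin p)) : ℝ≥0∞ :=
  ENNReal.ofReal (modelPrior h X S) * (∫⁻ θ, fracLik h X y θ ∂(priorGiven h X y S)) /
    evidence h X y

/-- The true law `N_n(X β, σ² I_n)` of the data. -/
def dataLaw (X : Matrix (Fin n) (Fin p) ℝ) (β : EuclideanSpace ℝ (Fin p)) (σ : ℝ) :
    Measure (EuclideanSpace ℝ (Fin n)) :=
  multivariateGaussian (WithLp.toLp 2 (X *ᵥ β.ofLp)) (σ ^ 2 • (1 : Matrix (Fin n) (Fin n) ℝ))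

/-- The squared Hellinger distance `∫ (√dP - √dQ)²`, with values in `[0, 2]` for probability
measures. -/
def hellingerSq {E : Type*} [MeasurableSpace E] (P Q : Measure E) : ℝ≥0∞ :=
  ∫⁻ x, ENNReal.ofReal
    ((√(P.rnDeriv (P + Q) x).toReal - √(Q.rnDeriv (P + Q) x).toReal) ^ 2) ∂(P + Q)

/-- The total variation distance `sup_A |P(A) - Q(A)|` of probability measures. -/
def tvDist {E : Type*} [MeasurableSpace E] (P Q : Measure E) : ℝ≥0∞ :=
  ⨆ (A : Set E) (_ : MeasurableSet A), ENNReal.ofReal |P.real A - Q.real A|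

end EmpiricalBayes

end

noncomputable section

namespace EmpiricalBayes

section

/-- Tilting the standard Gaussian by a Gaussian factor rescales it. -/
theorem gaussianReal_withDensity_exp {c : ℝ} (hc : 0 < c) :
    (gaussianReal 0 1).withDensity
        (fun x => ENNReal.ofReal (Real.exp (-((c ^ 2)⁻¹ - 1) / 2 * x ^ 2))) =
      ENNReal.ofReal c • (gaussianReal 0 1).map (fun x => c * x) := by
  have hv : NNReal.mk (c ^ 2) (sq_nonneg c) * 1 ≠ 0 := by
    rw [mul_one]
    exact fun h => (pow_pos hc 2).ne' (congrArg NNReal.toReal h)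
  rw [gaussianReal_map_const_mul, mul_zero, gaussianReal_of_var_ne_zero _ one_ne_zero,
    gaussianReal_of_var_ne_zero _ hv,
    ← withDensity_mul _ (measurable_gaussianPDF _ _) (by fun_prop),
    ← withDensity_smul _ (measurable_gaussianPDF _ _)]
  congr 1
  ext x
  simp only [Pi.mul_apply, Pi.smul_apply, smul_eq_mul, gaussianPDF]
  rw [← ENNReal.ofReal_mul (gaussianPDFReal_nonneg _ _ _), ← ENNReal.ofReal_mul hc.le]
  congr 1
  simp only [gaussianPDFReal, NNReal.coe_mk, NNReal.coe_one, mul_one, sub_zero]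
  rw [Real.sqrt_mul' _ (sq_nonneg c), Real.sqrt_sq hc.le, mul_assoc, ← Real.exp_add]
  field_simp
  ring_nf

theorem pi_gaussianReal_withDensity_exp {ι : Type*} [Fintype ι] {c : ℝ} (hc : 0 < c) :
    (Measure.pi fun _ : ι => gaussianReal 0 1).withDensity
        (fun x => ∏ i, ENNReal.ofReal (Real.exp (-((c ^ 2)⁻¹ - 1) / 2 * x i ^ 2))) =
      ENNReal.ofReal c ^ Fintype.card ι •
        (Measure.pi fun _ : ι => gaussianReal 0 1).map (fun x i => c * x i) := by
  rw [Measure.pi_map_pi (fun _ => by fun_prop)]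
  have : IsProbabilityMeasure ((gaussianReal 0 1).map (fun x => c * x)) :=
    Measure.isProbabilityMeasure_map (by fun_prop)
  have hC0 : ENNReal.ofReal c ^ Fintype.card ι ≠ 0 :=
    pow_ne_zero _ (ENNReal.ofReal_pos.2 hc).ne'
  have hCt : ENNReal.ofReal c ^ Fintype.card ι ≠ ∞ := ENNReal.pow_ne_top ENNReal.ofReal_ne_top
  rw [← one_smul ℝ≥0∞ (Measure.withDensity _ _), ← ENNReal.mul_inv_cancel hC0 hCt, mul_smul]
  congr 1
  symm
  refine Measure.pi_eq fun s hs => ?_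
  set f : ℝ → ℝ≥0∞ := fun x => ENNReal.ofReal (Real.exp (-((c ^ 2)⁻¹ - 1) / 2 * x ^ 2)) with hf
  have hfm : Measurable f := by fun_prop
  have h1 : ∀ i, ∫⁻ x in s i, f x ∂(gaussianReal 0 1) =
      ENNReal.ofReal c * (gaussianReal 0 1).map (fun x => c * x) (s i) := by
    intro i
    rw [← withDensity_apply _ (hs i), gaussianReal_withDensity_exp hc]
    simp
  have h2 : ∀ x : ι → ℝ, (Set.univ.pi s).indicator (fun x => ∏ i, f (x i)) x =
      ∏ i, (s i).indicator f (x i) := by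
    intro x
    by_cases hx : x ∈ Set.univ.pi s
    · rw [Set.indicator_of_mem hx]
      exact Finset.prod_congr rfl fun i _ => (Set.indicator_of_mem (hx i trivial) _).symm
    · rw [Set.indicator_of_notMem hx]
      simp only [Set.mem_pi, Set.mem_univ, true_imp_iff, not_forall] at hx
      obtain ⟨i, hi⟩ := hx
      exact (Finset.prod_eq_zero (Finset.mem_univ i) (Set.indicator_of_notMem hi _)).symm
  rw [Measure.smul_apply, withDensity_apply _ (MeasurableSet.univ_pi hs),
    ← lintegral_indicator (MeasurableSet.univ_pi hs), lintegral_congr h2,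
    lintegral_prod_eq_prod_lintegral_of_indepFun Finset.univ
      (fun i (x : ι → ℝ) => (s i).indicator f (x i))
      (iIndepFun_pi fun i => (hfm.indicator (hs i)).aemeasurable)
      (fun i => (hfm.indicator (hs i)).comp (measurable_pi_apply i))]
  have h3 : ∀ i, ∫⁻ x : ι → ℝ, (s i).indicator f (x i) ∂(Measure.pi fun _ => gaussianReal 0 1) =
      ENNReal.ofReal c * (gaussianReal 0 1).map (fun x => c * x) (s i) := by
    intro i
    rw [(measurePreserving_eval (fun _ : ι => gaussianReal 0 1) i).lintegral_comp
      (hfm.indicator (hs i)), lintegral_indicator (hs i), h1]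
  simp only [h3, Finset.prod_mul_distrib, Finset.prod_const, Finset.card_univ, smul_eq_mul]
  rw [← mul_assoc, ENNReal.inv_mul_cancel hC0 hCt, one_mul]

/-- Gaussian weights in an integral against the standard Gaussian amount to a rescaling. -/
theorem lintegral_stdGaussian_mul_exp {ι : Type*} [Fintype ι] {c : ℝ} (hc : 0 < c)
    {F : EuclideanSpace ℝ ι → ℝ≥0∞} (hF : Measurable F) :
    ∫⁻ z, F z * ENNReal.ofReal (Real.exp (-((c ^ 2)⁻¹ - 1) / 2 * ‖z‖ ^ 2))
        ∂(stdGaussian (EuclideanSpace ℝ ι)) =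
      ENNReal.ofReal c ^ Fintype.card ι * ∫⁻ z, F (c • z) ∂(stdGaussian (EuclideanSpace ℝ ι)) := by
  rw [← map_pi_eq_stdGaussian, lintegral_map (by fun_prop) (by fun_prop),
    lintegral_map (by fun_prop) (by fun_prop)]
  have h1 : ∀ x : ι → ℝ, ENNReal.ofReal
      (Real.exp (-((c ^ 2)⁻¹ - 1) / 2 * ‖(WithLp.toLp 2 x : EuclideanSpace ℝ ι)‖ ^ 2)) =
      ∏ i, ENNReal.ofReal (Real.exp (-((c ^ 2)⁻¹ - 1) / 2 * x i ^ 2)) := by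
    intro x
    rw [← ENNReal.ofReal_prod_of_nonneg (fun i _ => (Real.exp_pos _).le), ← Real.exp_sum,
      ← Finset.mul_sum, EuclideanSpace.real_norm_sq_eq]
  simp only [h1, mul_comm (F _)]
  have h2 := lintegral_withDensity_eq_lintegral_mul (Measure.pi fun _ : ι => gaussianReal 0 1)
    (f := fun x => ∏ i, ENNReal.ofReal (Real.exp (-((c ^ 2)⁻¹ - 1) / 2 * x i ^ 2)))
    (g := fun x => F (WithLp.toLp 2 x)) (by fun_prop) (by fun_prop)
  simp only [Pi.mul_apply] at h2
  rw [← h2, pi_gaussianReal_withDensity_exp hc, lintegral_smul_measure,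
    lintegral_map (by fun_prop) (by fun_prop)]
  rfl

theorem measurable_extendZero {p : ℕ} (S : Finset (Fin p)) : Measurable (extendZero S) := by
  unfold extendZero
  refine (WithLp.measurable_toLp 2 _).comp (measurable_pi_lambda _ fun j => ?_)
  by_cases hj : j ∈ S
  · simp only [hj, dif_pos]; fun_prop
  · simp only [hj, dif_neg, not_false_eq_true]; fun_prop

variable {n p : ℕ}

theorem posSemidef_inv_gram (X : Matrix (Fin n) (Fin p) ℝ) (S : Finset (Fin p)) :
    ((gram X S)⁻¹).PosSemidef := by
  refine Matrix.PosSemidef.inv ?_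
  have := Matrix.posSemidef_conjTranspose_mul_self (subDesign X S)
  rwa [Matrix.conjTranspose_eq_transpose_of_trivial] at this

section
open scoped MatrixOrder

/-- The affine parametrization of `normalDirac` by a standard Gaussian vector. -/
def gaussParam (X : Matrix (Fin n) (Fin p) ℝ) (y : EuclideanSpace ℝ (Fin n))
    (S : Finset (Fin p)) (r : ℝ) (z : EuclideanSpace ℝ S) : EuclideanSpace ℝ (Fin p) :=
  extendZero S (leastSquares X y S +
    r • Matrix.toEuclideanCLM (𝕜 := ℝ) (CFC.sqrt ((gram X S)⁻¹)) z)

theorem measurable_gaussParam (X : Matrix (Fin n) (Fin p) ℝ) (y : EuclideanSpace ℝ (Fin n))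
    (S : Finset (Fin p)) (r : ℝ) : Measurable (gaussParam X y S r) :=
  (measurable_extendZero S).comp (by fun_prop)

theorem gaussParam_smul (X : Matrix (Fin n) (Fin p) ℝ) (y : EuclideanSpace ℝ (Fin n))
    (S : Finset (Fin p)) (r c : ℝ) (z : EuclideanSpace ℝ S) :
    gaussParam X y S r (c • z) = gaussParam X y S (r * c) z := by
  simp [gaussParam, mul_smul]

theorem sqrt_smul_matrix {m : Type*} [Fintype m] [DecidableEq m] {A : Matrix m m ℝ}
    (hA : A.PosSemidef) {v : ℝ} (hv : 0 ≤ v) : CFC.sqrt (v • A) = √v • CFC.sqrt A := by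
  refine CFC.sqrt_unique ?_ (smul_nonneg (Real.sqrt_nonneg v) (CFC.sqrt_nonneg A))
  rw [smul_mul_smul_comm, Real.mul_self_sqrt hv, CFC.sqrt_mul_sqrt_self _ hA.nonneg]

theorem normalDirac_eq_map (X : Matrix (Fin n) (Fin p) ℝ) (y : EuclideanSpace ℝ (Fin n))
    (S : Finset (Fin p)) {v : ℝ} (hv : 0 ≤ v) :
    normalDirac X y S v = (stdGaussian (EuclideanSpace ℝ S)).map (gaussParam X y S √v) := by
  rw [normalDirac, multivariateGaussian, sqrt_smul_matrix (posSemidef_inv_gram X S) hv,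
    Measure.map_map (measurable_extendZero S) (by fun_prop)]
  congr 1
  ext z
  simp [gaussParam]

instance (X : Matrix (Fin n) (Fin p) ℝ) (y : EuclideanSpace ℝ (Fin n))
    (S : Finset (Fin p)) (v : ℝ) : IsProbabilityMeasure (normalDirac X y S v) :=
  Measure.isProbabilityMeasure_map (measurable_extendZero S).aemeasurable

end

theorem indicator_preimage_one_congr {E F : Type*} {f g : E → F} {A : Set F} {x z : E}
    (h : f x = g z) :
    (f ⁻¹' A).indicator (1 : E → ℝ≥0∞) x = (g ⁻¹' A).indicator (1 : E → ℝ≥0∞) z := by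
  classical
  simp only [Set.indicator_apply, Set.mem_preimage, h, Pi.one_apply]

/-- Scaling a centered Gaussian down by `c ≤ 1` multiplies densities by at most `c ^ (-dim)`. -/
theorem normalDirac_pow_mul_le (X : Matrix (Fin n) (Fin p) ℝ) (y : EuclideanSpace ℝ (Fin n))
    (S : Finset (Fin p)) {v w : ℝ} (hv : 0 < v) (hvw : v ≤ w)
    {A : Set (EuclideanSpace ℝ (Fin p))} (hA : MeasurableSet A) :
    ENNReal.ofReal (√(v / w)) ^ S.card * normalDirac X y S v A ≤ normalDirac X y S w A := by
  have hw : 0 < w := hv.trans_le hvw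
  have hc : 0 < √(v / w) := by positivity
  have hc1 : (√(v / w)) ^ 2 ≤ 1 := by
    rw [Real.sq_sqrt (by positivity)]
    exact (div_le_one hw).2 hvw
  rw [normalDirac_eq_map X y S hv.le, normalDirac_eq_map X y S hw.le,
    Measure.map_apply (measurable_gaussParam X y S _) hA,
    Measure.map_apply (measurable_gaussParam X y S _) hA]
  have hm : MeasurableSet (gaussParam X y S √w ⁻¹' A) := measurable_gaussParam X y S _ hA
  have key := lintegral_stdGaussian_mul_exp (ι := S) hc
    (F := (gaussParam X y S √w ⁻¹' A).indicator 1) (measurable_one.indicator hm)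
  have h1 : ∀ z : EuclideanSpace ℝ S, (gaussParam X y S √w ⁻¹' A).indicator (1 : EuclideanSpace ℝ S → ℝ≥0∞)
      (√(v / w) • z) = (gaussParam X y S √v ⁻¹' A).indicator 1 z := by
    intro z
    have : √w * √(v / w) = √v := by
      rw [← Real.sqrt_mul hw.le, mul_div_cancel₀ _ hw.ne']
    exact indicator_preimage_one_congr (by rw [gaussParam_smul, this])
  rw [lintegral_congr h1, lintegral_indicator_one (measurable_gaussParam X y S _ hA),
    Fintype.card_coe] at key
  rw [← key, ← lintegral_indicator_one hm]
  refine lintegral_mono fun z => ?_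
  refine mul_le_of_le_one_right' ?_
  rw [← ENNReal.ofReal_one]
  refine ENNReal.ofReal_le_ofReal (Real.exp_le_one_iff.2 ?_)
  have : 1 ≤ ((√(v / w)) ^ 2)⁻¹ := one_le_inv_iff₀.2 ⟨by positivity, hc1⟩
  nlinarith [sq_nonneg ‖z‖]

theorem one_sub_sqrt_pow_le {t : ℝ} (ht : 0 ≤ t) (ht1 : t ≤ 1) (s : ℕ) :
    1 - √t ^ s ≤ s * (1 - t) := by
  have h1 : t ≤ √t := Real.le_sqrt_of_sq_le (by nlinarith)
  have h2 := one_add_mul_le_pow (a := √t - 1) (by linarith [Real.sqrt_nonneg t]) s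
  rw [add_sub_cancel] at h2
  nlinarith [Nat.cast_nonneg (α := ℝ) s]

/-- A set of larger `P`-measure, up to a factor, gives a bound in the opposite direction. -/
theorem measure_le_add_of_mul_le {E : Type*} [MeasurableSpace E] {P Q : Measure E}
    [IsProbabilityMeasure P] {t d : ℝ} (hd : 1 - t ≤ d)
    {A : Set E} (h : ENNReal.ofReal t * P A ≤ Q A) : P A ≤ Q A + ENNReal.ofReal d := by
  calc P A = 1 * P A := (one_mul _).symm
    _ ≤ (ENNReal.ofReal t + ENNReal.ofReal (1 - t)) * P A := by
        gcongr
        rw [← ENNReal.ofReal_one]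
        calc ENNReal.ofReal 1 = ENNReal.ofReal (t + (1 - t)) := by ring_nf
          _ ≤ _ := ENNReal.ofReal_add_le
    _ = ENNReal.ofReal t * P A + ENNReal.ofReal (1 - t) * P A := add_mul _ _ _
    _ ≤ Q A + ENNReal.ofReal d := by
        gcongr
        exact (mul_le_of_le_one_right' prob_le_one).trans (ENNReal.ofReal_le_ofReal hd)

theorem measure_compl_le_add {E : Type*} [MeasurableSpace E] {P Q : Measure E}
    [IsProbabilityMeasure P] [IsProbabilityMeasure Q] {δ : ℝ≥0∞} {A : Set E}
    (hA : MeasurableSet A) (h : P A ≤ Q A + δ) : Q Aᶜ ≤ P Aᶜ + δ := by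
  rw [prob_compl_eq_one_sub hA, prob_compl_eq_one_sub hA, tsub_le_iff_right]
  calc 1 = 1 - P A + P A := (tsub_add_cancel_of_le prob_le_one).symm
    _ ≤ 1 - P A + (Q A + δ) := by gcongr
    _ = 1 - P A + δ + Q A := by rw [add_comm (Q A), add_assoc]

/-- Total variation bound between the normal laws with scale factors `v` and `w`. -/
theorem normalDirac_le_add (X : Matrix (Fin n) (Fin p) ℝ) (y : EuclideanSpace ℝ (Fin n))
    (S : Finset (Fin p)) {v w : ℝ} (hv : 0 < v) (hw : 0 < w)
    {A : Set (EuclideanSpace ℝ (Fin p))} (hA : MeasurableSet A) :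
    normalDirac X y S v A ≤
      normalDirac X y S w A + ENNReal.ofReal (S.card * |v / w - 1|) := by
  rcases le_total v w with h | h
  · have ht : v / w ≤ 1 := (div_le_one hw).2 h
    refine measure_le_add_of_mul_le (t := √(v / w) ^ S.card) ?_ ?_
    · rw [abs_sub_comm, abs_of_nonneg (by linarith)]
      exact one_sub_sqrt_pow_le (by positivity) ht _
    · rw [ENNReal.ofReal_pow (Real.sqrt_nonneg _)]
      exact normalDirac_pow_mul_le X y S hv h hA
  · have ht : w / v ≤ 1 := (div_le_one hv).2 h
    have hvw : 1 ≤ v / w := (one_le_div hw).2 h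
    rw [← compl_compl A]
    refine measure_compl_le_add hA.compl ?_
    refine measure_le_add_of_mul_le (t := √(w / v) ^ S.card) ?_ ?_
    · rw [abs_of_nonneg (by linarith)]
      refine (one_sub_sqrt_pow_le (by positivity) ht _).trans ?_
      refine mul_le_mul_of_nonneg_left ?_ (Nat.cast_nonneg _)
      rw [← inv_div v w] at ht ⊢
      have h3 : (v / w)⁻¹ * (v / w) = 1 := inv_mul_cancel₀ (by positivity)
      nlinarith
    · rw [ENNReal.ofReal_pow (Real.sqrt_nonneg _)]
      exact normalDirac_pow_mul_le X y S hw h hA.compl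

end

section

variable {n p : ℕ}

theorem mulVec_extendZero (X : Matrix (Fin n) (Fin p) ℝ) (S : Finset (Fin p))
    (b : EuclideanSpace ℝ S) : X *ᵥ (extendZero S b).ofLp = subDesign X S *ᵥ b.ofLp := by
  ext i
  simp only [Matrix.mulVec, dotProduct, subDesign, extendZero, Matrix.submatrix_apply, id_eq]
  rw [← Finset.sum_subset (Finset.subset_univ S) (fun j _ hj => by simp [hj]), ← Finset.sum_coe_sort S]
  exact Finset.sum_congr rfl fun j _ => by simp

/-- The residual sum of squares of the least squares fit in the model `S`. -/
def rss (X : Matrix (Fin n) (Fin p) ℝ) (y : EuclideanSpace ℝ (Fin n)) (S : Finset (Fin p)) : ℝ :=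
  ‖y - WithLp.toLp 2 (subDesign X S *ᵥ (leastSquares X y S).ofLp)‖ ^ 2

theorem rss_nonneg (X : Matrix (Fin n) (Fin p) ℝ) (y : EuclideanSpace ℝ (Fin n))
    (S : Finset (Fin p)) : 0 ≤ rss X y S := sq_nonneg _

theorem norm_sq_eq_dotProduct {m : Type*} [Fintype m] (x : EuclideanSpace ℝ m) :
    ‖x‖ ^ 2 = x.ofLp ⬝ᵥ x.ofLp := by
  rw [EuclideanSpace.real_norm_sq_eq, dotProduct]
  simp only [sq]

theorem transpose_mulVec_residual (X : Matrix (Fin n) (Fin p) ℝ) (y : EuclideanSpace ℝ (Fin n))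
    {S : Finset (Fin p)} (hS : IsUnit (gram X S)) :
    (subDesign X S)ᵀ *ᵥ (y.ofLp - subDesign X S *ᵥ (leastSquares X y S).ofLp) = 0 := by
  have hdet := (Matrix.isUnit_iff_isUnit_det _).1 hS
  rw [Matrix.mulVec_sub, leastSquares, Matrix.mulVec_mulVec, Matrix.mulVec_mulVec,
    show (subDesign X S)ᵀ * subDesign X S = gram X S from rfl, Matrix.mul_nonsing_inv _ hdet,
    Matrix.one_mulVec, sub_self]

theorem norm_sq_sub_mulVec (X : Matrix (Fin n) (Fin p) ℝ) (y : EuclideanSpace ℝ (Fin n))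
    {S : Finset (Fin p)} (hS : IsUnit (gram X S)) (u : EuclideanSpace ℝ S) :
    ‖y - WithLp.toLp 2 (subDesign X S *ᵥ (leastSquares X y S + u).ofLp)‖ ^ 2 =
      rss X y S + u.ofLp ⬝ᵥ (gram X S *ᵥ u.ofLp) := by
  have h0 := transpose_mulVec_residual X y hS
  rw [rss, norm_sq_eq_dotProduct, norm_sq_eq_dotProduct]
  simp only [WithLp.ofLp_sub, WithLp.ofLp_add, Matrix.mulVec_add]
  set r := y.ofLp - subDesign X S *ᵥ (leastSquares X y S).ofLp with hr
  have h1 : r ⬝ᵥ (subDesign X S *ᵥ u.ofLp) = 0 := by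
    rw [Matrix.dotProduct_mulVec, ← Matrix.mulVec_transpose, h0, zero_dotProduct]
  have h2 : (subDesign X S *ᵥ u.ofLp) ⬝ᵥ (subDesign X S *ᵥ u.ofLp) =
      u.ofLp ⬝ᵥ (gram X S *ᵥ u.ofLp) := by
    rw [Matrix.dotProduct_mulVec, ← Matrix.mulVec_transpose, Matrix.mulVec_mulVec, dotProduct_comm]
    rfl
  rw [← sub_sub, ← hr]
  clear_value r
  rw [sub_dotProduct, dotProduct_sub, dotProduct_sub, h1,
    dotProduct_comm (subDesign X S *ᵥ u.ofLp) r, h1, h2]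
  ring

section
open scoped MatrixOrder

theorem norm_sq_sub_gaussParam (X : Matrix (Fin n) (Fin p) ℝ) (y : EuclideanSpace ℝ (Fin n))
    {S : Finset (Fin p)} (hS : IsUnit (gram X S)) (r : ℝ) (z : EuclideanSpace ℝ S) :
    ‖y - WithLp.toLp 2 (X *ᵥ (gaussParam X y S r z).ofLp)‖ ^ 2 =
      rss X y S + r ^ 2 * ‖z‖ ^ 2 := by
  have hdet := (Matrix.isUnit_iff_isUnit_det _).1 hS
  have hA := posSemidef_inv_gram X S
  rw [gaussParam, mulVec_extendZero, norm_sq_sub_mulVec X y hS]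
  set Q := CFC.sqrt ((gram X S)⁻¹) with hQ
  have hQQ : Q * Q = (gram X S)⁻¹ := CFC.sqrt_mul_sqrt_self _ hA.nonneg
  have hQt : Qᵀ = Q := by
    have := (CFC.sqrt_nonneg ((gram X S)⁻¹)).isSelfAdjoint
    rw [← Matrix.conjTranspose_eq_transpose_of_trivial]
    exact this
  have hone : Q * gram X S * Q = 1 := by
    rw [mul_eq_one_comm, ← mul_assoc, hQQ, Matrix.nonsing_inv_mul _ hdet]
  congr 1
  have : (r • Matrix.toEuclideanCLM (𝕜 := ℝ) Q z).ofLp = r • (Q *ᵥ z.ofLp) := by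
    rw [WithLp.ofLp_smul, Matrix.ofLp_toEuclideanCLM]
  rw [this, norm_sq_eq_dotProduct, Matrix.mulVec_smul, smul_dotProduct, dotProduct_smul,
    smul_eq_mul, smul_eq_mul, ← mul_assoc, sq]
  congr 1
  have hsym : Q *ᵥ z.ofLp = z.ofLp ᵥ* Q := by rw [← Matrix.mulVec_transpose, hQt]
  rw [Matrix.mulVec_mulVec, hsym, ← Matrix.dotProduct_mulVec, Matrix.mulVec_mulVec, ← mul_assoc,
    hone, Matrix.one_mulVec]

end

theorem measurable_fracLik (h : HyperParams) (X : Matrix (Fin n) (Fin p) ℝ)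
    (y : EuclideanSpace ℝ (Fin n)) : Measurable (fracLik h X y) := by
  unfold fracLik
  have h1 : Measurable fun θ : EuclideanSpace ℝ (Fin p) × ℝ =>
      y - WithLp.toLp 2 (X *ᵥ θ.1.ofLp) := by
    refine measurable_const.sub ?_
    have : Measurable (fun β : EuclideanSpace ℝ (Fin p) => WithLp.toLp 2 (X *ᵥ β.ofLp)) :=
      ((Matrix.toEuclideanLin X).continuous_of_finiteDimensional).measurable
    exact this.comp measurable_fst
  have h2 : Measurable fun θ : EuclideanSpace ℝ (Fin p) × ℝ => θ.2 := measurable_snd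
  refine ENNReal.measurable_ofReal.comp (Measurable.mul ?_ ?_)
  · exact (measurable_const.mul h2).pow_const _
  · exact ((measurable_const.div (measurable_const.mul h2)).neg.mul (h1.norm.pow_const 2)).exp

/-- The factor contributed by the likelihood at variance `v` after `β` is integrated out. -/
def marginalLik (h : HyperParams) (X : Matrix (Fin n) (Fin p) ℝ) (y : EuclideanSpace ℝ (Fin n))
    (S : Finset (Fin p)) (v : ℝ) : ℝ :=
  (2 * Real.pi * v) ^ (-((n : ℝ) * h.α / 2)) * Real.exp (-(h.α / (2 * v)) * rss X y S) *
    √(h.γ / (h.α + h.γ)) ^ S.card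

/-- Conjugacy: given `σ² = v`, the fractional likelihood turns the prior law
`N(β̂_S, v γ⁻¹ (X_Sᵀ X_S)⁻¹)` into `N(β̂_S, v (α + γ)⁻¹ (X_Sᵀ X_S)⁻¹)`. -/
theorem setLIntegral_fracLik_normalDirac {h : HyperParams} (hh : h.Admissible)
    (X : Matrix (Fin n) (Fin p) ℝ) (y : EuclideanSpace ℝ (Fin n))
    {S : Finset (Fin p)} (hS : IsUnit (gram X S)) {v : ℝ} (hv : 0 < v)
    {A : Set (EuclideanSpace ℝ (Fin p))} (hA : MeasurableSet A) :
    ∫⁻ β in A, fracLik h X y (β, v) ∂(normalDirac X y S (v * h.γ⁻¹)) =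
      ENNReal.ofReal (marginalLik h X y S v) * normalDirac X y S (v / (h.α + h.γ)) A := by
  have hα := hh.α_pos
  have hγ := hh.γ_pos
  have hL : Measurable fun β => fracLik h X y (β, v) :=
    (measurable_fracLik h X y).comp (by fun_prop)
  have hr1 : 0 ≤ v * h.γ⁻¹ := by positivity
  have hr2 : 0 ≤ v / (h.α + h.γ) := by positivity
  have hc : 0 < √(h.γ / (h.α + h.γ)) := by positivity
  have hm := measurable_gaussParam X y S √(v * h.γ⁻¹)
  rw [normalDirac_eq_map X y S hr1, normalDirac_eq_map X y S hr2,
    Measure.map_apply (measurable_gaussParam X y S _) hA, ← lintegral_indicator hA,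
    lintegral_map (hL.indicator hA) hm]
  have key := lintegral_stdGaussian_mul_exp (ι := S) hc
    (F := (gaussParam X y S √(v * h.γ⁻¹) ⁻¹' A).indicator 1) (measurable_one.indicator (hm hA))
  have h1 : ∀ z : EuclideanSpace ℝ S, (gaussParam X y S √(v * h.γ⁻¹) ⁻¹' A).indicator
      (1 : EuclideanSpace ℝ S → ℝ≥0∞) (√(h.γ / (h.α + h.γ)) • z) =
      (gaussParam X y S √(v / (h.α + h.γ)) ⁻¹' A).indicator 1 z := by
    intro z
    have : √(v * h.γ⁻¹) * √(h.γ / (h.α + h.γ)) = √(v / (h.α + h.γ)) := by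
      rw [← Real.sqrt_mul hr1]
      congr 1
      field_simp
    exact indicator_preimage_one_congr (by rw [gaussParam_smul, this])
  rw [lintegral_congr h1, lintegral_indicator_one (measurable_gaussParam X y S _ hA),
    Fintype.card_coe] at key
  have h2 : marginalLik h X y S v = ((2 * Real.pi * v) ^ (-((n : ℝ) * h.α / 2)) *
      Real.exp (-(h.α / (2 * v)) * rss X y S)) * √(h.γ / (h.α + h.γ)) ^ S.card := rfl
  rw [h2, ENNReal.ofReal_mul (by positivity), ENNReal.ofReal_pow hc.le, mul_assoc, ← key,
    ← lintegral_const_mul' _ _ ENNReal.ofReal_ne_top]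
  refine lintegral_congr fun z => ?_
  by_cases hz : gaussParam X y S √(v * h.γ⁻¹) z ∈ A
  · rw [Set.indicator_of_mem hz, Set.indicator_of_mem (by exact hz), Pi.one_apply, one_mul,
      ← ENNReal.ofReal_mul (by positivity), mul_assoc, ← Real.exp_add, fracLik]
    simp only
    rw [norm_sq_sub_gaussParam X y hS, Real.sq_sqrt hr1, Real.sq_sqrt (by positivity)]
    congr 3
    field_simp
    ring
  · rw [Set.indicator_of_notMem hz, Set.indicator_of_notMem (by exact hz), zero_mul, mul_zero]

end

section

theorem integral_invGamma_kernel {A B : ℝ} (hA : 0 < A) (hB : 0 < B) :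
    ∫ v in Set.Ioi (0 : ℝ), v ^ (-A - 1) * Real.exp (-B / v) = B⁻¹ ^ A * Real.Gamma A := by
  have h := integral_comp_rpow_Ioi (fun y : ℝ => y ^ (A - 1) * Real.exp (-(B * y)))
    (p := -1) (by norm_num)
  rw [Real.integral_rpow_mul_exp_neg_mul_Ioi hA hB, one_div] at h
  rw [← h]
  refine setIntegral_congr_fun measurableSet_Ioi fun v (hv : 0 < v) => ?_
  simp only [abs_neg, abs_one, one_mul, smul_eq_mul]
  rw [Real.rpow_neg_one, Real.inv_rpow hv.le, ← Real.rpow_neg hv.le, ← mul_assoc,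
    ← Real.rpow_add hv]
  congr 2
  · ring
  · rw [← div_eq_mul_inv, neg_div]

theorem integrableOn_invGamma_kernel {A B : ℝ} (hA : 0 < A) (hB : 0 < B) :
    IntegrableOn (fun v => v ^ (-A - 1) * Real.exp (-B / v)) (Set.Ioi (0 : ℝ)) := by
  by_contra hc
  have h := integral_invGamma_kernel hA hB
  rw [integral_undef hc] at h
  have : 0 < B⁻¹ ^ A * Real.Gamma A :=
    mul_pos (Real.rpow_pos_of_pos (inv_pos.2 hB) _) (Real.Gamma_pos_of_pos hA)
  linarith

theorem lintegral_invGamma_kernel {A B : ℝ} (hA : 0 < A) (hB : 0 < B) :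
    ∫⁻ v in Set.Ioi (0 : ℝ), ENNReal.ofReal (v ^ (-A - 1) * Real.exp (-B / v)) =
      ENNReal.ofReal (B⁻¹ ^ A * Real.Gamma A) := by
  rw [← integral_invGamma_kernel hA hB,
    ofReal_integral_eq_lintegral_ofReal (integrableOn_invGamma_kernel hA hB)]
  filter_upwards [self_mem_ae_restrict measurableSet_Ioi] with v hv
  exact mul_nonneg (Real.rpow_nonneg (le_of_lt hv) _) (Real.exp_pos _).le

theorem invGamma_const_pred {A B : ℝ} (hA : 0 < A) (hB : 0 < B) :
    B⁻¹ ^ A * Real.Gamma A = B / A * (B⁻¹ ^ (A + 1) * Real.Gamma (A + 1)) := by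
  rw [Real.Gamma_add_one hA.ne', Real.rpow_add (inv_pos.2 hB), Real.rpow_one]
  field_simp

/-- The relative first absolute deviation of an inverse gamma variable from `w`. -/
theorem lintegral_invGamma_kernel_abs_le {A B w : ℝ} (hA : 2 < A) (hB : 0 < B) (hw : 0 < w) :
    ∫⁻ v in Set.Ioi (0 : ℝ), ENNReal.ofReal (v ^ (-A - 1) * Real.exp (-B / v)) *
        ENNReal.ofReal |v / w - 1| ≤
      ENNReal.ofReal (B⁻¹ ^ A * Real.Gamma A) *
        ENNReal.ofReal (B / (A - 1) / w / √(A - 2) + |B / (A - 1) / w - 1|) := by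
  have hA0 : 0 < A - 2 := by linarith
  have hA1 : 0 < A - 1 := by linarith
  have hA2 : 0 < A := by linarith
  set m := B / (A - 1) with hm
  have hm0 : 0 < m := by positivity
  set q := √(A - 2) with hq
  have hq0 : 0 < q := Real.sqrt_pos.2 hA0
  have hq2 : q ^ 2 = A - 2 := Real.sq_sqrt hA0.le
  set f : ℝ → ℝ := fun v => v ^ (-A - 1) * Real.exp (-B / v) with hf
  set f1 : ℝ → ℝ := fun v => v ^ (-(A - 1) - 1) * Real.exp (-B / v) with hf1
  set f2 : ℝ → ℝ := fun v => v ^ (-(A - 2) - 1) * Real.exp (-B / v) with hf2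
  have i0 : IntegrableOn f (Set.Ioi 0) := integrableOn_invGamma_kernel hA2 hB
  have i1 : IntegrableOn f1 (Set.Ioi 0) := integrableOn_invGamma_kernel hA1 hB
  have i2 : IntegrableOn f2 (Set.Ioi 0) := integrableOn_invGamma_kernel hA0 hB
  have j0 : ∫ v in Set.Ioi 0, f v = _ := integral_invGamma_kernel hA2 hB
  have j1 : ∫ v in Set.Ioi 0, f1 v = _ := integral_invGamma_kernel hA1 hB
  have j2 : ∫ v in Set.Ioi 0, f2 v = _ := integral_invGamma_kernel hA0 hB
  set J := B⁻¹ ^ A * Real.Gamma A with hJ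
  have hJ0 : 0 ≤ J :=
    mul_nonneg (Real.rpow_nonneg (inv_pos.2 hB).le _) (Real.Gamma_pos_of_pos hA2).le
  have r1 : B⁻¹ ^ (A - 1) * Real.Gamma (A - 1) = m * J := by
    rw [invGamma_const_pred hA1 hB, sub_add_cancel]
  have r2 : B⁻¹ ^ (A - 2) * Real.Gamma (A - 2) = B / (A - 2) * (m * J) := by
    rw [← r1, invGamma_const_pred hA0 hB]
    norm_num [sub_add]
  rw [r1] at j1
  rw [r2] at j2
  have e1 : ∀ v : ℝ, 0 < v → f1 v = v * f v := by
    intro v hv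
    simp only [hf1, hf]
    rw [show -(A - 1) - 1 = 1 + (-A - 1) by ring, Real.rpow_add hv, Real.rpow_one, mul_assoc]
  have e2 : ∀ v : ℝ, 0 < v → f2 v = v ^ 2 * f v := by
    intro v hv
    simp only [hf2, hf]
    rw [show -(A - 2) - 1 = 2 + (-A - 1) by ring, Real.rpow_add hv, Real.rpow_two, mul_assoc]
  set k0 := (m * q + m / q) / (2 * w) + |m / w - 1| with hk0
  set k1 := q / w with hk1
  set k2 := q / m / (2 * w) with hk2
  have i01 : IntegrableOn (fun v => k0 * f v - k1 * f1 v) (Set.Ioi (0 : ℝ)) :=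
    (i0.const_mul k0).sub (i1.const_mul k1)
  have hint : IntegrableOn (fun v => k0 * f v - k1 * f1 v + k2 * f2 v) (Set.Ioi (0 : ℝ)) :=
    i01.add (i2.const_mul k2)
  have hval : ∫ v in Set.Ioi (0 : ℝ), (k0 * f v - k1 * f1 v + k2 * f2 v) =
      J * (m / w / q + |m / w - 1|) := by
    rw [integral_add i01 (i2.const_mul k2),
      integral_sub (i0.const_mul k0) (i1.const_mul k1), integral_const_mul, integral_const_mul,
      integral_const_mul, j0, j1, j2]
    have hBm : B = m * (q ^ 2 + 1) := by
      rw [hq2, hm]; field_simp; ring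
    rw [← hq2, hBm, hk0, hk1, hk2]
    field_simp
    ring
  have hpt : ∀ v : ℝ, 0 < v → f v * |v / w - 1| ≤ k0 * f v - k1 * f1 v + k2 * f2 v := by
    intro v hv
    have hfv : 0 ≤ f v := mul_nonneg (Real.rpow_nonneg hv.le _) (Real.exp_pos _).le
    rw [e1 v hv, e2 v hv]
    have h1 : |v / w - 1| ≤ |v - m| / w + |m / w - 1| := by
      have : v / w - 1 = (v - m) / w + (m / w - 1) := by ring
      rw [this]
      refine (abs_add_le _ _).trans (le_of_eq ?_)
      rw [abs_div, abs_of_pos hw]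
    have h2 : |v - m| ≤ (q / m * (v - m) ^ 2 + m / q) / 2 := by
      have h3 : 0 ≤ m / q * (q / m * |v - m| - 1) ^ 2 := by positivity
      have h4 : m / q * (q / m * |v - m| - 1) ^ 2 =
          q / m * |v - m| ^ 2 - 2 * |v - m| + m / q := by
        field_simp
        ring
      rw [h4, sq_abs] at h3
      linarith
    have h5 : |v / w - 1| ≤ k0 - k1 * v + k2 * v ^ 2 := by
      refine h1.trans ?_
      have h6 : |v - m| / w ≤ (q / m * (v - m) ^ 2 + m / q) / 2 / w := by gcongr
      refine (add_le_add_left h6 _).trans (le_of_eq ?_)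
      rw [hk0, hk1, hk2]
      field_simp
      ring
    calc f v * |v / w - 1| ≤ f v * (k0 - k1 * v + k2 * v ^ 2) := by gcongr
      _ = _ := by ring
  rw [← ENNReal.ofReal_mul hJ0, ← hval, ofReal_integral_eq_lintegral_ofReal hint]
  · refine setLIntegral_mono' measurableSet_Ioi fun v (hv : 0 < v) => ?_
    have hfv : 0 ≤ f v := mul_nonneg (Real.rpow_nonneg hv.le _) (Real.exp_pos _).le
    rw [← ENNReal.ofReal_mul hfv]
    exact ENNReal.ofReal_le_ofReal (hpt v hv)
  · filter_upwards [self_mem_ae_restrict measurableSet_Ioi] with v hv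
    have hfv : 0 ≤ f v := mul_nonneg (Real.rpow_nonneg (le_of_lt hv) _) (Real.exp_pos _).le
    exact (mul_nonneg hfv (abs_nonneg _)).trans (hpt v hv)

variable {n p : ℕ}

/-- Shape of the conditional posterior of `σ²` given a model. -/
def postShape (h : HyperParams) (n : ℕ) : ℝ := h.a₀ + n * h.α / 2

/-- Scale of the conditional posterior of `σ²` given the model `S`. -/
def postScale (h : HyperParams) (X : Matrix (Fin n) (Fin p) ℝ) (y : EuclideanSpace ℝ (Fin n))
    (S : Finset (Fin p)) : ℝ := h.b₀ + h.α / 2 * rss X y S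

theorem postScale_pos {h : HyperParams} (hh : h.Admissible) (X : Matrix (Fin n) (Fin p) ℝ)
    (y : EuclideanSpace ℝ (Fin n)) (S : Finset (Fin p)) : 0 < postScale h X y S :=
  add_pos_of_pos_of_nonneg hh.b₀_pos
    (mul_nonneg (half_pos hh.α_pos).le (rss_nonneg X y S))

/-- The constant relating `marginalLik` times the prior density to the inverse gamma kernel. -/
def margConst (h : HyperParams) (n s : ℕ) : ℝ :=
  (2 * Real.pi) ^ (-((n : ℝ) * h.α / 2)) * √(h.γ / (h.α + h.γ)) ^ s *
    (h.b₀ ^ h.a₀ / Real.Gamma h.a₀)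

theorem margConst_pos {h : HyperParams} (hh : h.Admissible) (n s : ℕ) : 0 < margConst h n s := by
  have := hh.α_pos
  have := hh.γ_pos
  have := hh.b₀_pos
  have := Real.Gamma_pos_of_pos hh.a₀_pos
  unfold margConst
  positivity

theorem measurable_marginalLik (h : HyperParams) (X : Matrix (Fin n) (Fin p) ℝ)
    (y : EuclideanSpace ℝ (Fin n)) (S : Finset (Fin p)) : Measurable (marginalLik h X y S) := by
  unfold marginalLik
  refine Measurable.mul (Measurable.mul ?_ ?_) measurable_const
  · exact (measurable_const.mul measurable_id).pow_const _
  · exact ((measurable_const.div (measurable_const.mul measurable_id)).neg.mul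
      measurable_const).exp

theorem lintegral_marginalLik_mul {h : HyperParams} (hh : h.Admissible)
    (X : Matrix (Fin n) (Fin p) ℝ) (y : EuclideanSpace ℝ (Fin n)) (S : Finset (Fin p))
    {G : ℝ → ℝ≥0∞} (hG : Measurable G) :
    ∫⁻ v, ENNReal.ofReal (marginalLik h X y S v) * G v ∂(invGamma h.a₀ h.b₀) =
      ENNReal.ofReal (margConst h n S.card) * ∫⁻ v in Set.Ioi (0 : ℝ),
        ENNReal.ofReal (v ^ (-postShape h n - 1) * Real.exp (-postScale h X y S / v)) * G v := by
  have hM := measurable_marginalLik h X y S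
  have hb := hh.b₀_pos
  have hΓ := Real.Gamma_pos_of_pos hh.a₀_pos
  have hdens : Measurable fun v : ℝ => ENNReal.ofReal
      (if 0 < v then Real.exp (-h.b₀ / v) * v ^ (-h.a₀ - 1) * h.b₀ ^ h.a₀ / Real.Gamma h.a₀
        else 0) := by
    refine ENNReal.measurable_ofReal.comp (Measurable.ite measurableSet_Ioi ?_ measurable_const)
    fun_prop
  rw [invGamma, lintegral_withDensity_eq_lintegral_mul _ hdens (by fun_prop),
    ← lintegral_const_mul' _ _ ENNReal.ofReal_ne_top, ← lintegral_indicator measurableSet_Ioi]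
  refine lintegral_congr fun v => ?_
  rw [Pi.mul_apply]
  by_cases hv : 0 < v
  · rw [Set.indicator_of_mem (show v ∈ Set.Ioi 0 from hv), if_pos hv, ← mul_assoc, ← mul_assoc,
      ← ENNReal.ofReal_mul (by positivity), ← ENNReal.ofReal_mul (margConst_pos hh _ _).le]
    congr 2
    rw [marginalLik, margConst, postShape, postScale,
      Real.mul_rpow (by positivity) hv.le,
      show -(h.a₀ + n * h.α / 2) - 1 = (-h.a₀ - 1) + -(n * h.α / 2) by ring, Real.rpow_add hv,
      show -(h.b₀ + h.α / 2 * rss X y S) / v = -h.b₀ / v + -(h.α / (2 * v)) * rss X y S by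
        field_simp; ring, Real.exp_add]
    ring
  · rw [Set.indicator_of_notMem (show v ∉ Set.Ioi 0 from hv), if_neg hv, ENNReal.ofReal_zero,
      zero_mul]

theorem ae_invGamma_pos (a₀ b₀ : ℝ) : ∀ᵐ v ∂(invGamma a₀ b₀), 0 < v := by
  rw [invGamma, ae_withDensity_iff]
  · refine Eventually.of_forall fun v hv => ?_
    by_contra hcon
    simp [hcon] at hv
  · refine ENNReal.measurable_ofReal.comp (Measurable.ite measurableSet_Ioi ?_ measurable_const)
    fun_prop

end

section

theorem tvDist_le {E : Type*} [MeasurableSpace E] {P Q : Measure E}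
    [IsProbabilityMeasure P] [IsProbabilityMeasure Q] {δ : ℝ≥0∞}
    (h : ∀ A, MeasurableSet A → P A ≤ Q A + δ) : tvDist P Q ≤ δ := by
  refine iSup₂_le fun A hA => ?_
  have h1 := h A hA
  have h2 : Q A ≤ P A + δ := by
    have := measure_compl_le_add hA.compl (h _ hA.compl)
    rwa [compl_compl] at this
  rcases eq_or_ne δ ∞ with rfl | hδ
  · exact le_top
  refine ENNReal.ofReal_le_of_le_toReal (abs_sub_le_iff.2 ⟨?_, ?_⟩)
  · have := ENNReal.toReal_mono (by finiteness) h1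
    rw [ENNReal.toReal_add (by finiteness) hδ] at this
    simp only [Measure.real]
    linarith
  · have := ENNReal.toReal_mono (by finiteness) h2
    rw [ENNReal.toReal_add (by finiteness) hδ] at this
    simp only [Measure.real]
    linarith

theorem sq_sqrt_sub_sqrt_le {x y : ℝ} (hx : 0 ≤ x) (hxy : x ≤ y) : (√x - √y) ^ 2 ≤ y - x := by
  have h1 := Real.sq_sqrt hx
  have h2 := Real.sq_sqrt (hx.trans hxy)
  have h3 := Real.sqrt_le_sqrt hxy
  nlinarith [Real.sqrt_nonneg x]

theorem setLIntegral_rnDeriv_sub_le {E : Type*} [MeasurableSpace E] {P Q ν : Measure E}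
    [IsProbabilityMeasure P] [IsProbabilityMeasure Q] [IsFiniteMeasure ν] (hP : P ≪ ν) (hQ : Q ≪ ν)
    {δ : ℝ≥0∞} {A : Set E} (hA : MeasurableSet A) (h : P A ≤ Q A + δ)
    (hle : ∀ x ∈ A, Q.rnDeriv ν x ≤ P.rnDeriv ν x) :
    ∫⁻ x in A, (P.rnDeriv ν x - Q.rnDeriv ν x) ∂ν ≤ δ := by
  rw [lintegral_sub (Measure.measurable_rnDeriv _ _), Measure.setLIntegral_rnDeriv hP,
    Measure.setLIntegral_rnDeriv hQ, tsub_le_iff_right, add_comm]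
  · exact h
  · rw [Measure.setLIntegral_rnDeriv hQ]; finiteness
  · filter_upwards [self_mem_ae_restrict hA] with x hx using hle x hx

theorem hellingerSq_le {E : Type*} [MeasurableSpace E] {P Q : Measure E}
    [IsProbabilityMeasure P] [IsProbabilityMeasure Q] {δ : ℝ≥0∞}
    (h : ∀ A, MeasurableSet A → P A ≤ Q A + δ) : hellingerSq P Q ≤ 2 * δ := by
  have hP : P ≪ P + Q := Measure.absolutelyContinuous_of_le (Measure.le_add_right le_rfl)
  have hQ : Q ≪ P + Q := Measure.absolutelyContinuous_of_le (Measure.le_add_left le_rfl)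
  have hfP := Measure.rnDeriv_lt_top P (P + Q)
  have hfQ := Measure.rnDeriv_lt_top Q (P + Q)
  set f := P.rnDeriv (P + Q) with hf
  set g := Q.rnDeriv (P + Q) with hg
  have hA : MeasurableSet {x | g x ≤ f x} :=
    measurableSet_le (Measure.measurable_rnDeriv _ _) (Measure.measurable_rnDeriv _ _)
  have hpt : ∀ {a b : ℝ≥0∞}, a < ∞ → b < ∞ → a ≤ b →
      ENNReal.ofReal ((√a.toReal - √b.toReal) ^ 2) ≤ b - a := by
    intro a b ha hb hab
    rw [← ENNReal.ofReal_toReal hb.ne, ← ENNReal.ofReal_toReal ha.ne,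
      ← ENNReal.ofReal_sub _ ENNReal.toReal_nonneg, ENNReal.toReal_ofReal ENNReal.toReal_nonneg,
      ENNReal.toReal_ofReal ENNReal.toReal_nonneg]
    exact ENNReal.ofReal_le_ofReal
      (sq_sqrt_sub_sqrt_le ENNReal.toReal_nonneg (ENNReal.toReal_mono hb.ne hab))
  rw [hellingerSq, ← lintegral_add_compl _ hA, two_mul]
  refine add_le_add ?_ ?_
  · refine le_trans (lintegral_mono_ae ?_)
      (setLIntegral_rnDeriv_sub_le hP hQ hA (h _ hA) fun x hx => hx)
    filter_upwards [self_mem_ae_restrict hA, ae_restrict_of_ae hfP, ae_restrict_of_ae hfQ]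
      with x hx h1 h2
    rw [sub_sq_comm]
    exact hpt h2 h1 hx
  · have h' : Q {x | g x ≤ f x}ᶜ ≤ P {x | g x ≤ f x}ᶜ + δ := measure_compl_le_add hA (h _ hA)
    refine le_trans (lintegral_mono_ae ?_)
      (setLIntegral_rnDeriv_sub_le hQ hP hA.compl h' fun x hx => (Set.mem_compl_iff _ _ |>.1 hx |> not_le.1).le)
    filter_upwards [self_mem_ae_restrict hA.compl, ae_restrict_of_ae hfP, ae_restrict_of_ae hfQ]
      with x hx h1 h2
    exact hpt h1 h2 (Set.mem_compl_iff _ _ |>.1 hx |> not_le.1).le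

variable {n p : ℕ}

/-- The unnormalized posterior mass that the model `S` gives to `β ∈ A`. -/
def modelMass (h : HyperParams) (X : Matrix (Fin n) (Fin p) ℝ) (y : EuclideanSpace ℝ (Fin n))
    (S : Finset (Fin p)) (A : Set (EuclideanSpace ℝ (Fin p))) : ℝ≥0∞ :=
  ∫⁻ θ in Prod.fst ⁻¹' A, fracLik h X y θ ∂(priorGiven h X y S)

theorem modelMass_eq {h : HyperParams} (hh : h.Admissible) (X : Matrix (Fin n) (Fin p) ℝ)
    (y : EuclideanSpace ℝ (Fin n)) {S : Finset (Fin p)} (hS : IsUnit (gram X S))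
    {A : Set (EuclideanSpace ℝ (Fin p))} (hA : MeasurableSet A) :
    modelMass h X y S A = ∫⁻ v, ENNReal.ofReal (marginalLik h X y S v) *
      normalDirac X y S (v / (h.α + h.γ)) A ∂(invGamma h.a₀ h.b₀) := by
  have hL := measurable_fracLik h X y
  have hA' : MeasurableSet (Prod.fst ⁻¹' A : Set (EuclideanSpace ℝ (Fin p) × ℝ)) :=
    measurable_fst hA
  rw [modelMass, ← lintegral_indicator hA', priorGiven,
    Measure.lintegral_bind (aemeasurable_conditional h hh.γ_pos X y S)
      (hL.indicator hA').aemeasurable]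
  refine lintegral_congr_ae ?_
  filter_upwards [ae_invGamma_pos h.a₀ h.b₀] with v hv
  rw [lintegral_map (hL.indicator hA') (by fun_prop),
    ← setLIntegral_fracLik_normalDirac hh X y hS hv hA, ← lintegral_indicator hA]
  rfl

theorem modelMass_univ {h : HyperParams} (hh : h.Admissible) (X : Matrix (Fin n) (Fin p) ℝ)
    (y : EuclideanSpace ℝ (Fin n)) {S : Finset (Fin p)} (hS : IsUnit (gram X S)) :
    modelMass h X y S Set.univ = ENNReal.ofReal (margConst h n S.card) *
      ENNReal.ofReal ((postScale h X y S)⁻¹ ^ postShape h n * Real.Gamma (postShape h n)) := by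
  have hA : 0 < postShape h n := by
    have := hh.a₀_pos
    have := hh.α_pos
    unfold postShape
    positivity
  rw [modelMass_eq hh X y hS MeasurableSet.univ,
    ← lintegral_invGamma_kernel hA (postScale_pos hh X y S)]
  have := lintegral_marginalLik_mul hh X y S (G := 1) measurable_one
  simpa using this

theorem modelMass_univ_pos {h : HyperParams} (hh : h.Admissible) (X : Matrix (Fin n) (Fin p) ℝ)
    (y : EuclideanSpace ℝ (Fin n)) {S : Finset (Fin p)} (hS : IsUnit (gram X S)) :
    0 < modelMass h X y S Set.univ := by
  have hA : 0 < postShape h n := by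
    have := hh.a₀_pos
    have := hh.α_pos
    unfold postShape
    positivity
  rw [modelMass_univ hh X y hS]
  refine ENNReal.mul_pos (ENNReal.ofReal_pos.2 (margConst_pos hh _ _)).ne'
    (ENNReal.ofReal_pos.2 (mul_pos (Real.rpow_pos_of_pos (inv_pos.2 (postScale_pos hh X y S)) _)
      (Real.Gamma_pos_of_pos hA))).ne'

/-- Bound on the relative deviation of `σ²` from `w` under its conditional posterior. -/
def varDeviation (h : HyperParams) (X : Matrix (Fin n) (Fin p) ℝ) (y : EuclideanSpace ℝ (Fin n))
    (S : Finset (Fin p)) (w : ℝ) : ℝ :=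
  postScale h X y S / (postShape h n - 1) / w / √(postShape h n - 2) +
    |postScale h X y S / (postShape h n - 1) / w - 1|

theorem modelMass_le {h : HyperParams} (hh : h.Admissible) (X : Matrix (Fin n) (Fin p) ℝ)
    (y : EuclideanSpace ℝ (Fin n)) {S : Finset (Fin p)} (hS : IsUnit (gram X S))
    (hshape : 2 < postShape h n) {w : ℝ} (hw : 0 < w)
    {A : Set (EuclideanSpace ℝ (Fin p))} (hA : MeasurableSet A) :
    modelMass h X y S A ≤ modelMass h X y S Set.univ * (normalDirac X y S (w / (h.α + h.γ)) A +
      ENNReal.ofReal (S.card * varDeviation h X y S w)) := by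
  have hαγ : 0 < h.α + h.γ := add_pos hh.α_pos hh.γ_pos
  have hM : Measurable fun v => ENNReal.ofReal (marginalLik h X y S v) :=
    (measurable_marginalLik h X y S).ennreal_ofReal
  have hG : Measurable fun v : ℝ => ENNReal.ofReal |v / w - 1| := by fun_prop
  have hU : modelMass h X y S Set.univ =
      ∫⁻ v, ENNReal.ofReal (marginalLik h X y S v) ∂(invGamma h.a₀ h.b₀) := by
    rw [modelMass_eq hh X y hS MeasurableSet.univ]
    simp
  calc modelMass h X y S A
      = ∫⁻ v, ENNReal.ofReal (marginalLik h X y S v) *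
          normalDirac X y S (v / (h.α + h.γ)) A ∂(invGamma h.a₀ h.b₀) := modelMass_eq hh X y hS hA
    _ ≤ ∫⁻ v, (ENNReal.ofReal (marginalLik h X y S v) * normalDirac X y S (w / (h.α + h.γ)) A +
          (S.card : ℝ≥0∞) * (ENNReal.ofReal (marginalLik h X y S v) * ENNReal.ofReal |v / w - 1|))
            ∂(invGamma h.a₀ h.b₀) := by
        refine lintegral_mono_ae ?_
        filter_upwards [ae_invGamma_pos h.a₀ h.b₀] with v hv
        have h1 := normalDirac_le_add X y S (div_pos hv hαγ) (div_pos hw hαγ) hA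
        rw [div_div_div_cancel_right₀ hαγ.ne', ENNReal.ofReal_mul (Nat.cast_nonneg _),
          ENNReal.ofReal_natCast] at h1
        refine (mul_le_mul_right h1 _).trans (le_of_eq ?_)
        ring
    _ = modelMass h X y S Set.univ * normalDirac X y S (w / (h.α + h.γ)) A +
          (S.card : ℝ≥0∞) * ∫⁻ v, ENNReal.ofReal (marginalLik h X y S v) *
            ENNReal.ofReal |v / w - 1| ∂(invGamma h.a₀ h.b₀) := by
        rw [lintegral_add_left (hM.mul_const _), lintegral_mul_const _ hM,
          lintegral_const_mul' _ _ (ENNReal.natCast_ne_top _), hU]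
    _ ≤ modelMass h X y S Set.univ * normalDirac X y S (w / (h.α + h.γ)) A +
          (S.card : ℝ≥0∞) * (modelMass h X y S Set.univ *
            ENNReal.ofReal (varDeviation h X y S w)) := by
        gcongr
        rw [lintegral_marginalLik_mul hh X y S hG, modelMass_univ hh X y hS, mul_assoc]
        gcongr
        exact lintegral_invGamma_kernel_abs_le hshape (postScale_pos hh X y S) hw
    _ = _ := by
        rw [ENNReal.ofReal_mul (Nat.cast_nonneg _), ENNReal.ofReal_natCast]
        ring

theorem modelPrior_of_rank_lt (h : HyperParams) (X : Matrix (Fin n) (Fin p) ℝ)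
    {S : Finset (Fin p)} (hS : X.rank < S.card) : modelPrior h X S = 0 := by
  rw [modelPrior, sizePrior, if_neg (not_le.2 hS), mul_zero]

theorem modelPrior_pos {h : HyperParams} (hh : h.Admissible) (X : Matrix (Fin n) (Fin p) ℝ)
    {S : Finset (Fin p)} (hS : S.card ≤ X.rank) : 0 < modelPrior h X S := by
  have hc := hh.c_pos
  have hcard : S.card ≤ p := by simpa using S.card_le_univ
  have hterm : ∀ t : ℕ, t ≤ p → 0 < ((h.c * (p : ℝ) ^ h.a) ^ t)⁻¹ := by
    intro t ht
    rcases Nat.eq_zero_or_pos p with rfl | hp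
    · rw [Nat.le_zero.1 ht]; simp
    · have : (0 : ℝ) < p := Nat.cast_pos.2 hp
      positivity
  have hrank : X.rank ≤ p := by simpa using X.rank_le_card_width
  rw [modelPrior, sizePrior, if_pos hS]
  refine mul_pos (inv_pos.2 (Nat.cast_pos.2 (Nat.choose_pos hcard)))
    (div_pos (hterm _ hcard) (Finset.sum_pos (fun t ht => hterm t ?_) ⟨0, by simp⟩))
  exact (Nat.lt_succ_iff.1 (Finset.mem_range.1 ht)).trans hrank

theorem setLIntegral_fracLik_jointPrior (h : HyperParams) (X : Matrix (Fin n) (Fin p) ℝ)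
    (y : EuclideanSpace ℝ (Fin n)) (A : Set (EuclideanSpace ℝ (Fin p)))  :
    ∫⁻ θ in Prod.fst ⁻¹' A, fracLik h X y θ ∂(jointPrior h X y) =
      ∑ S : Finset (Fin p), ENNReal.ofReal (modelPrior h X S) * modelMass h X y S A := by
  rw [jointPrior, ← Measure.restrictₗ_apply, map_sum, lintegral_finsetSum_measure]
  refine Finset.sum_congr rfl fun S _ => ?_
  rw [Measure.restrictₗ_apply, Measure.restrict_smul, lintegral_smul_measure]
  rfl

theorem evidence_eq (h : HyperParams) (X : Matrix (Fin n) (Fin p) ℝ)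
    (y : EuclideanSpace ℝ (Fin n)) : evidence h X y =
      ∑ S : Finset (Fin p), ENNReal.ofReal (modelPrior h X S) * modelMass h X y S Set.univ := by
  rw [← setLIntegral_fracLik_jointPrior, evidence, Set.preimage_univ, Measure.restrict_univ]

theorem betaPosterior_apply (h : HyperParams) (X : Matrix (Fin n) (Fin p) ℝ)
    (y : EuclideanSpace ℝ (Fin n)) {A : Set (EuclideanSpace ℝ (Fin p))} (hA : MeasurableSet A) :
    betaPosterior h X y A = (evidence h X y)⁻¹ *
      ∑ S : Finset (Fin p), ENNReal.ofReal (modelPrior h X S) * modelMass h X y S A := by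
  rw [← setLIntegral_fracLik_jointPrior, betaPosterior, Measure.smul_apply, smul_eq_mul,
    Measure.map_apply measurable_fst hA, withDensity_apply _ (measurable_fst hA)]

theorem evidence_ne_top {h : HyperParams} (hh : h.Admissible) (X : Matrix (Fin n) (Fin p) ℝ)
    (y : EuclideanSpace ℝ (Fin n))
    (hX : ∀ S : Finset (Fin p), S.card ≤ X.rank → IsUnit (gram X S)) : evidence h X y ≠ ∞ := by
  rw [evidence_eq]
  refine ENNReal.sum_ne_top.2 fun S _ => ?_
  rcases le_or_gt S.card X.rank with hS | hS
  · rw [modelMass_univ hh X y (hX S hS)]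
    finiteness
  · simp [modelPrior_of_rank_lt h X hS]

theorem evidence_ne_zero {h : HyperParams} (hh : h.Admissible) (X : Matrix (Fin n) (Fin p) ℝ)
    (y : EuclideanSpace ℝ (Fin n))
    (hX : ∀ S : Finset (Fin p), S.card ≤ X.rank → IsUnit (gram X S)) : evidence h X y ≠ 0 := by
  rw [evidence_eq]
  intro h0
  have h1 := (Finset.sum_eq_zero_iff.1 h0) ∅ (Finset.mem_univ _)
  have hc : (∅ : Finset (Fin p)).card ≤ X.rank := by simp
  exact (ENNReal.mul_pos (ENNReal.ofReal_pos.2 (modelPrior_pos hh X hc)).ne'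
    (modelMass_univ_pos hh X y (hX _ hc)).ne').ne' h1

theorem isProbabilityMeasure_betaPosterior {h : HyperParams} (hh : h.Admissible)
    (X : Matrix (Fin n) (Fin p) ℝ) (y : EuclideanSpace ℝ (Fin n))
    (hX : ∀ S : Finset (Fin p), S.card ≤ X.rank → IsUnit (gram X S)) :
    IsProbabilityMeasure (betaPosterior h X y) :=
  ⟨by rw [betaPosterior_apply h X y MeasurableSet.univ, ← evidence_eq,
        ENNReal.inv_mul_cancel (evidence_ne_zero hh X y hX) (evidence_ne_top hh X y hX)]⟩

theorem modelPosterior_eq (h : HyperParams) (X : Matrix (Fin n) (Fin p) ℝ)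
    (y : EuclideanSpace ℝ (Fin n)) (S : Finset (Fin p)) :
    modelPosterior h X y S =
      (evidence h X y)⁻¹ * (ENNReal.ofReal (modelPrior h X S) * modelMass h X y S Set.univ) := by
  rw [modelPosterior, modelMass, Set.preimage_univ, Measure.restrict_univ, ENNReal.div_eq_inv_mul]

theorem modelPosterior_le_one {h : HyperParams} (hh : h.Admissible) (X : Matrix (Fin n) (Fin p) ℝ)
    (y : EuclideanSpace ℝ (Fin n))
    (hX : ∀ S : Finset (Fin p), S.card ≤ X.rank → IsUnit (gram X S)) (S : Finset (Fin p)) :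
    modelPosterior h X y S ≤ 1 := by
  rw [modelPosterior_eq,
    ← ENNReal.inv_mul_cancel (evidence_ne_zero hh X y hX) (evidence_ne_top hh X y hX)]
  gcongr
  rw [evidence_eq]
  exact Finset.single_le_sum (f := fun S : Finset (Fin p) =>
    ENNReal.ofReal (modelPrior h X S) * modelMass h X y S Set.univ)
    (fun _ _ => zero_le) (Finset.mem_univ S)

/-- The posterior of `β` is close to the normal law of a model with large posterior probability. -/
theorem betaPosterior_le {h : HyperParams} (hh : h.Admissible) (X : Matrix (Fin n) (Fin p) ℝ)
    (y : EuclideanSpace ℝ (Fin n))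
    (hX : ∀ S : Finset (Fin p), S.card ≤ X.rank → IsUnit (gram X S)) {S : Finset (Fin p)}
    (hS : S.card ≤ X.rank) (hshape : 2 < postShape h n) {w : ℝ} (hw : 0 < w)
    {A : Set (EuclideanSpace ℝ (Fin p))} (hA : MeasurableSet A) :
    betaPosterior h X y A ≤ normalDirac X y S (w / (h.α + h.γ)) A +
      ((1 - modelPosterior h X y S) + ENNReal.ofReal (S.card * varDeviation h X y S w)) := by
  have hE0 := evidence_ne_zero hh X y hX
  have hEt := evidence_ne_top hh X y hX
  have hle := modelPosterior_le_one hh X y hX S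
  set N := normalDirac X y S (w / (h.α + h.γ)) A
  set d := ENNReal.ofReal (S.card * varDeviation h X y S w)
  set T := fun S : Finset (Fin p) =>
    (evidence h X y)⁻¹ * (ENNReal.ofReal (modelPrior h X S) * modelMass h X y S Set.univ) with hT
  have hsum : ∑ S, T S = 1 := by
    rw [hT, ← Finset.mul_sum, ← evidence_eq, ENNReal.inv_mul_cancel hE0 hEt]
  have hTS : T S = modelPosterior h X y S := (modelPosterior_eq h X y S).symm
  have hmono : ∀ U, modelMass h X y U A ≤ modelMass h X y U Set.univ := fun U =>
    lintegral_mono_set (Set.preimage_mono (Set.subset_univ A))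
  have hrest : ∑ U ∈ Finset.univ.erase S, T U = 1 - T S := by
    rw [← hsum, ← Finset.add_sum_erase _ _ (Finset.mem_univ S), ENNReal.add_sub_cancel_left]
    rw [hTS]
    exact (hle.trans_lt ENNReal.one_lt_top).ne
  rw [betaPosterior_apply h X y hA, Finset.mul_sum, ← Finset.add_sum_erase _ _ (Finset.mem_univ S),
    ← hTS]
  calc _ ≤ T S * (N + d) + ∑ U ∈ Finset.univ.erase S, T U := by
        refine add_le_add ?_ (Finset.sum_le_sum fun U _ => ?_)
        · simp only [hT]
          rw [mul_assoc, mul_assoc]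
          gcongr
          exact modelMass_le hh X y (hX S hS) hshape hw hA
        · simp only [hT]
          gcongr
          exact hmono U
    _ ≤ 1 * (N + d) + (1 - T S) := by
        rw [hrest]
        gcongr
        exact hTS.trans_le hle
    _ = _ := by ring

end

section

/-- The squared norm of a standard Gaussian vector concentrates around the dimension. -/
theorem exists_lintegral_abs_norm_sq_sub_le : ∃ K : ℝ, 0 ≤ K ∧ ∀ n : ℕ, 0 < n →
    ∫⁻ z, ENNReal.ofReal |‖z‖ ^ 2 - n| ∂(stdGaussian (EuclideanSpace ℝ (Fin n))) ≤
      ENNReal.ofReal (K * √n) := by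
  have hmem : MemLp (fun x : ℝ => x ^ 2) 2 (gaussianReal 0 1) := by
    rw [memLp_two_iff_integrable_sq (by fun_prop)]
    have h4 := (memLp_id_gaussianReal (μ := 0) (v := 1) 4).integrable_norm_pow (by norm_num)
    refine h4.congr (Eventually.of_forall fun x => ?_)
    simp only [id_eq, Real.norm_eq_abs]
    rw [← pow_mul]
    exact Even.pow_abs (by decide) x
  set V := Var[fun x : ℝ => x ^ 2; gaussianReal 0 1] with hV
  have hV0 : 0 ≤ V := variance_nonneg _ _
  have hmean : ∫ x, x ^ 2 ∂(gaussianReal 0 1) = 1 := by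
    have h1 := variance_fun_id_gaussianReal (μ := 0) (v := 1)
    rw [variance_eq_integral (by fun_prop)] at h1
    simpa using h1
  refine ⟨(V + 1) / 2, by positivity, fun n hn => ?_⟩
  have hn' : (0 : ℝ) < n := Nat.cast_pos.2 hn
  have hq : 0 < √(n : ℝ) := Real.sqrt_pos.2 hn'
  have hqq : √(n : ℝ) ^ 2 = n := Real.sq_sqrt hn'.le
  set π := Measure.pi fun _ : Fin n => gaussianReal 0 1 with hπ
  set Y : (Fin n → ℝ) → ℝ := ∑ i, fun ω => ω i ^ 2 with hY
  have hYv : Var[Y; π] = n * V := by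
    have := variance_sum_pi (μ := fun _ : Fin n => gaussianReal 0 1) (X := fun _ x => x ^ 2)
      fun _ => hmem
    rw [hY, hπ, this]
    simp [hV]
  have hYm : MemLp Y 2 π := by
    rw [hY]
    exact memLp_finsetSum' _ fun i _ =>
      hmem.comp_measurePreserving (measurePreserving_eval (fun _ : Fin n => gaussianReal 0 1) i)
  have hYe : ∫ ω, Y ω ∂π = n := by
    have h1 : ∀ i : Fin n, ∫ ω : Fin n → ℝ, ω i ^ 2 ∂π = 1 := fun i => by
      rw [← hmean, ← (measurePreserving_eval (fun _ : Fin n => gaussianReal 0 1) i).map_eq,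
        integral_map (measurable_pi_apply i).aemeasurable (by fun_prop)]
    simp only [hY, Finset.sum_apply]
    rw [integral_finsetSum]
    · simp [h1]
    · intro i _
      exact ((hmem.comp_measurePreserving
        (measurePreserving_eval (fun _ : Fin n => gaussianReal 0 1) i)).integrable (by norm_num))
  have hvar : ∫ ω, (Y ω - n) ^ 2 ∂π = n * V := by
    rw [← hYv, variance_eq_integral hYm.aestronglyMeasurable.aemeasurable, hYe]
  have hint : Integrable (fun ω => (Y ω - n) ^ 2) π :=
    (hYm.sub (memLp_const _)).integrable_sq
  rw [← map_pi_eq_stdGaussian, lintegral_map (by fun_prop) (by fun_prop)]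
  have hnorm : ∀ ω : Fin n → ℝ, ‖(WithLp.toLp 2 ω : EuclideanSpace ℝ (Fin n))‖ ^ 2 = Y ω := by
    intro ω
    rw [EuclideanSpace.real_norm_sq_eq, hY, Finset.sum_apply]
  simp only [hnorm]
  have hint2 : Integrable (fun ω => ((Y ω - n) ^ 2 / √n + √n) / 2) π :=
    ((hint.div_const _).add (integrable_const _)).div_const _
  calc ∫⁻ ω, ENNReal.ofReal |Y ω - n| ∂π
      ≤ ∫⁻ ω, ENNReal.ofReal (((Y ω - n) ^ 2 / √n + √n) / 2) ∂π := by
        refine lintegral_mono fun ω => ENNReal.ofReal_le_ofReal ?_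
        rw [le_div_iff₀ two_pos, ← sub_nonneg]
        have : (Y ω - n) ^ 2 / √n + √n - |Y ω - n| * 2 = (|Y ω - n| - √n) ^ 2 / √n := by
          rw [← sq_abs (Y ω - n)]
          field_simp
          ring
        rw [this]
        positivity
    _ = ENNReal.ofReal (∫ ω, ((Y ω - n) ^ 2 / √n + √n) / 2 ∂π) := by
        rw [ofReal_integral_eq_lintegral_ofReal hint2]
        exact Eventually.of_forall fun ω => by positivity
    _ = ENNReal.ofReal ((V + 1) / 2 * √n) := by
        rw [integral_div, integral_add (hint.div_const _) (integrable_const _), integral_div, hvar]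
        congr 1
        simp only [integral_const, probReal_univ, one_smul]
        field_simp
        rw [hqq]
        ring
    _ ≤ _ := le_rfl

/-- The expectation of a quadratic form in a standard Gaussian vector is its trace. -/
theorem integral_stdGaussian_quadratic {n : ℕ} (P : Matrix (Fin n) (Fin n) ℝ) :
    Integrable (fun z : EuclideanSpace ℝ (Fin n) => z.ofLp ⬝ᵥ (P *ᵥ z.ofLp)) (stdGaussian _) ∧
      ∫ z : EuclideanSpace ℝ (Fin n), z.ofLp ⬝ᵥ (P *ᵥ z.ofLp) ∂(stdGaussian _) = P.trace := by
  have hmem : ∀ i : Fin n, MemLp (fun z : EuclideanSpace ℝ (Fin n) => z i) 2 (stdGaussian _) := by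
    intro i
    have h1 : MemLp (id : EuclideanSpace ℝ (Fin n) → _) 2 (stdGaussian _) :=
      IsGaussian.memLp_two_id
    exact (EuclideanSpace.proj (𝕜 := ℝ) i).comp_memLp' h1
  have hmean : ∀ i : Fin n, ∫ z : EuclideanSpace ℝ (Fin n), z i ∂(stdGaussian _) = 0 := fun i =>
    integral_strongDual_stdGaussian (EuclideanSpace.proj (𝕜 := ℝ) i)
  have hcov : ∀ i j : Fin n, ∫ z : EuclideanSpace ℝ (Fin n), z i * z j ∂(stdGaussian _) =
      (1 : Matrix (Fin n) (Fin n) ℝ) i j := by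
    intro i j
    have h1 := covariance_eval_multivariateGaussian (μ := 0)
      (Matrix.PosSemidef.one (n := Fin n) (R := ℝ)) i j
    rw [multivariateGaussian_zero_one, covariance_eq_sub (hmem i) (hmem j), hmean i] at h1
    simpa using h1
  have hint : ∀ i j : Fin n, Integrable (fun z : EuclideanSpace ℝ (Fin n) =>
      P i j * (z i * z j)) (stdGaussian _) := fun i j =>
    ((hmem i).integrable_mul (hmem j)).const_mul _
  have hexp : ∀ z : EuclideanSpace ℝ (Fin n), z.ofLp ⬝ᵥ (P *ᵥ z.ofLp) =
      ∑ i, ∑ j, P i j * (z i * z j) := by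
    intro z
    simp only [dotProduct, Matrix.mulVec, Finset.mul_sum]
    exact Finset.sum_congr rfl fun i _ => Finset.sum_congr rfl fun j _ => by ring
  simp only [hexp]
  refine ⟨integrable_finsetSum _ fun i _ => integrable_finsetSum _ fun j _ => hint i j, ?_⟩
  rw [integral_finsetSum _ fun i _ => integrable_finsetSum _ fun j _ => hint i j]
  rw [Matrix.trace]
  refine Finset.sum_congr rfl fun i _ => ?_
  rw [integral_finsetSum _ fun j _ => hint i j]
  simp only [integral_const_mul, hcov, Matrix.one_apply]
  simp

variable {n p : ℕ}

/-- The orthogonal projection onto the column space of `X_S`. -/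
def hatMatrix (X : Matrix (Fin n) (Fin p) ℝ) (S : Finset (Fin p)) : Matrix (Fin n) (Fin n) ℝ :=
  subDesign X S * (gram X S)⁻¹ * (subDesign X S)ᵀ

theorem trace_hatMatrix (X : Matrix (Fin n) (Fin p) ℝ) {S : Finset (Fin p)}
    (hS : IsUnit (gram X S)) : (hatMatrix X S).trace = S.card := by
  have hdet := (Matrix.isUnit_iff_isUnit_det _).1 hS
  rw [hatMatrix, Matrix.trace_mul_comm, ← Matrix.mul_assoc,
    show (subDesign X S)ᵀ * subDesign X S = gram X S from rfl, Matrix.mul_nonsing_inv _ hdet,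
    Matrix.trace_one, Fintype.card_coe]

theorem hatMatrix_quadratic_nonneg (X : Matrix (Fin n) (Fin p) ℝ) (S : Finset (Fin p))
    (z : Fin n → ℝ) : 0 ≤ z ⬝ᵥ (hatMatrix X S *ᵥ z) := by
  have h1 := (posSemidef_inv_gram X S).dotProduct_mulVec_nonneg ((subDesign X S)ᵀ *ᵥ z)
  rw [star_trivial] at h1
  rw [hatMatrix, ← Matrix.mulVec_mulVec, ← Matrix.mulVec_mulVec, Matrix.dotProduct_mulVec,
    ← Matrix.mulVec_transpose]
  exact h1

theorem rss_eq_sub (X : Matrix (Fin n) (Fin p) ℝ) (z : EuclideanSpace ℝ (Fin n))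
    {S : Finset (Fin p)} (hS : IsUnit (gram X S)) :
    rss X z S = ‖z‖ ^ 2 - z.ofLp ⬝ᵥ (hatMatrix X S *ᵥ z.ofLp) := by
  have hdet := (Matrix.isUnit_iff_isUnit_det _).1 hS
  have h1 := norm_sq_sub_mulVec X z hS (-leastSquares X z S)
  rw [add_neg_cancel, WithLp.ofLp_zero, Matrix.mulVec_zero, WithLp.toLp_zero, sub_zero,
    WithLp.ofLp_neg, Matrix.mulVec_neg, dotProduct_neg, neg_dotProduct, neg_neg] at h1
  have h2 : gram X S *ᵥ (leastSquares X z S).ofLp = (subDesign X S)ᵀ *ᵥ z.ofLp := by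
    rw [leastSquares, Matrix.mulVec_mulVec, Matrix.mul_nonsing_inv _ hdet, Matrix.one_mulVec]
  have h3 : hatMatrix X S *ᵥ z.ofLp = subDesign X S *ᵥ (leastSquares X z S).ofLp := by
    rw [hatMatrix, leastSquares, Matrix.mulVec_mulVec, Matrix.mulVec_mulVec, Matrix.mul_assoc]
  rw [h1, h2, h3, Matrix.dotProduct_mulVec z.ofLp, ← Matrix.mulVec_transpose,
    dotProduct_comm ((subDesign X S)ᵀ *ᵥ z.ofLp), add_sub_cancel_right]

theorem extendZero_support (β : EuclideanSpace ℝ (Fin p)) :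
    extendZero (support β) (WithLp.toLp 2 fun j => β j) = β := by
  ext j
  by_cases hj : β j = 0 <;> simp [extendZero, support, hj]

theorem rss_add_smul (X : Matrix (Fin n) (Fin p) ℝ) (S : Finset (Fin p)) (hS : IsUnit (gram X S))
    (b : EuclideanSpace ℝ S) (σ : ℝ) (z : EuclideanSpace ℝ (Fin n)) :
    rss X (WithLp.toLp 2 (X *ᵥ (extendZero S b).ofLp) + σ • z) S = σ ^ 2 * rss X z S := by
  have hdet := (Matrix.isUnit_iff_isUnit_det _).1 hS
  have h1 : (leastSquares X (WithLp.toLp 2 (X *ᵥ (extendZero S b).ofLp) + σ • z) S).ofLp =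
      b.ofLp + σ • (leastSquares X z S).ofLp := by
    simp only [leastSquares, mulVec_extendZero, WithLp.ofLp_add, WithLp.ofLp_smul,
      Matrix.mulVec_add, Matrix.mulVec_smul]
    rw [Matrix.mulVec_mulVec, Matrix.mulVec_mulVec, Matrix.mul_assoc,
      show (subDesign X S)ᵀ * subDesign X S = gram X S from rfl, Matrix.nonsing_inv_mul _ hdet,
      Matrix.one_mulVec]
  rw [rss, rss, h1, mulVec_extendZero, Matrix.mulVec_add, Matrix.mulVec_smul, WithLp.toLp_add,
    WithLp.toLp_smul, add_sub_add_left_eq_sub, ← smul_sub, norm_smul, mul_pow, Real.norm_eq_abs,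
    sq_abs]

section
open scoped MatrixOrder

theorem dataLaw_eq_map (X : Matrix (Fin n) (Fin p) ℝ) (β : EuclideanSpace ℝ (Fin p)) {σ : ℝ}
    (hσ : 0 < σ) : dataLaw X β σ = (stdGaussian (EuclideanSpace ℝ (Fin n))).map
      (fun z => WithLp.toLp 2 (X *ᵥ β.ofLp) + σ • z) := by
  rw [dataLaw, multivariateGaussian, sqrt_smul_matrix Matrix.PosSemidef.one (sq_nonneg σ),
    Real.sqrt_sq hσ.le, CFC.sqrt_one]
  simp

end

instance (X : Matrix (Fin n) (Fin p) ℝ) (β : EuclideanSpace ℝ (Fin p)) (σ : ℝ) :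
    IsProbabilityMeasure (dataLaw X β σ) := by
  unfold dataLaw
  infer_instance

theorem continuous_leastSquares (X : Matrix (Fin n) (Fin p) ℝ) (S : Finset (Fin p)) :
    Continuous fun y => leastSquares X y S := by
  unfold leastSquares
  refine (PiLp.continuous_toLp 2 _).comp ?_
  refine Continuous.matrix_mulVec continuous_const ?_
  exact Continuous.matrix_mulVec continuous_const (PiLp.continuous_ofLp 2 _)

theorem measurable_rss (X : Matrix (Fin n) (Fin p) ℝ) (S : Finset (Fin p)) :
    Measurable fun y => rss X y S := by
  unfold rss
  refine Continuous.measurable ?_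
  refine Continuous.pow (continuous_norm.comp (continuous_id.sub ?_)) 2
  refine (PiLp.continuous_toLp 2 _).comp ?_
  refine Continuous.matrix_mulVec continuous_const ?_
  exact (PiLp.continuous_ofLp 2 _).comp (continuous_leastSquares X S)

/-- The residual sum of squares in the true model concentrates around `n σ²`. -/
theorem lintegral_abs_rss_sub_le {K : ℝ} (hK0 : 0 ≤ K)
    (hK : ∫⁻ z, ENNReal.ofReal |‖z‖ ^ 2 - n| ∂(stdGaussian (EuclideanSpace ℝ (Fin n))) ≤
      ENNReal.ofReal (K * √n))
    (X : Matrix (Fin n) (Fin p) ℝ) (β : EuclideanSpace ℝ (Fin p)) {σ : ℝ} (hσ : 0 < σ)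
    (hS : IsUnit (gram X (support β))) :
    ∫⁻ y, ENNReal.ofReal |rss X y (support β) / σ ^ 2 - n| ∂(dataLaw X β σ) ≤
      ENNReal.ofReal (K * √n + (support β).card) := by
  have hm : Measurable fun y => ENNReal.ofReal |rss X y (support β) / σ ^ 2 - n| := by
    have := measurable_rss X (support β)
    fun_prop
  rw [dataLaw_eq_map X β hσ, lintegral_map hm (by fun_prop)]
  obtain ⟨hqi, hq⟩ := integral_stdGaussian_quadratic (hatMatrix X (support β))
  rw [trace_hatMatrix X hS] at hq
  calc _ ≤ ∫⁻ z : EuclideanSpace ℝ (Fin n), (ENNReal.ofReal |‖z‖ ^ 2 - n| +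
          ENNReal.ofReal (z.ofLp ⬝ᵥ (hatMatrix X (support β) *ᵥ z.ofLp))) ∂(stdGaussian _) := by
        refine lintegral_mono fun z => ?_
        have h0 := hatMatrix_quadratic_nonneg X (support β) z.ofLp
        rw [← ENNReal.ofReal_add (abs_nonneg _) h0]
        refine ENNReal.ofReal_le_ofReal ?_
        have h1 := rss_add_smul X (support β) hS (WithLp.toLp 2 fun j => β j) σ z
        rw [extendZero_support] at h1
        rw [h1, mul_div_cancel_left₀ _ (by positivity), rss_eq_sub X z hS, sub_right_comm]
        refine (abs_sub _ _).trans ?_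
        rw [abs_of_nonneg h0]
    _ = ∫⁻ z : EuclideanSpace ℝ (Fin n), ENNReal.ofReal |‖z‖ ^ 2 - n| ∂(stdGaussian _) +
          ENNReal.ofReal (support β).card := by
        rw [lintegral_add_left (by fun_prop), ← hq, ofReal_integral_eq_lintegral_ofReal hqi]
        exact Eventually.of_forall fun z => hatMatrix_quadratic_nonneg X (support β) z.ofLp
    _ ≤ _ := by
        rw [ENNReal.ofReal_add (by positivity) (Nat.cast_nonneg _)]
        gcongr

end

section

variable {n p : ℕ}

theorem varDeviation_le {h : HyperParams} (hh : h.Admissible) (X : Matrix (Fin n) (Fin p) ℝ)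
    (y : EuclideanSpace ℝ (Fin n)) (S : Finset (Fin p)) {w d : ℝ} (hd : 0 < d) (hdw : d ≤ w)
    (hshape : 3 ≤ postShape h n) :
    varDeviation h X y S w ≤ 1 / √(postShape h n - 2) + 2 * (h.b₀ / d + h.a₀ + 1) /
      (postShape h n - 1) + h.α / (postShape h n - 1) * |rss X y S / w - n| := by
  have hw : 0 < w := hd.trans_le hdw
  have hα := hh.α_pos
  have ha := hh.a₀_pos
  have hb := hh.b₀_pos
  have hA1 : 0 < postShape h n - 1 := by linarith
  set q := √(postShape h n - 2) with hq
  have hq1 : 1 ≤ q := Real.one_le_sqrt.2 (by linarith)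
  set m := postScale h X y S / (postShape h n - 1) / w with hm
  set D := |m - 1| with hD
  have hD0 : 0 ≤ D := abs_nonneg _
  have h1 : m / q ≤ 1 / q + D := by
    have h2 : m ≤ 1 + D := by linarith [le_abs_self (m - 1)]
    calc m / q ≤ (1 + D) / q := by gcongr
      _ = 1 / q + D / q := add_div _ _ _
      _ ≤ 1 / q + D := by gcongr; exact div_le_self hD0 hq1
  have h3 : D ≤ (h.b₀ / d + h.a₀ + 1 + h.α / 2 * |rss X y S / w - n|) / (postShape h n - 1) := by
    have h4 : m - 1 = (h.b₀ / w - h.a₀ + 1 + h.α / 2 * (rss X y S / w - n)) /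
        (postShape h n - 1) := by
      rw [hm, eq_div_iff hA1.ne', sub_mul, div_right_comm, div_mul_cancel₀ _ hA1.ne']
      simp only [postScale, postShape]
      ring
    rw [hD, h4, abs_div, abs_of_pos hA1]
    gcongr
    refine (abs_add_le _ _).trans ?_
    rw [abs_mul, abs_of_pos (half_pos hα)]
    gcongr
    have h5 : h.b₀ / w ≤ h.b₀ / d := by gcongr
    have h6 : 0 < h.b₀ / w := by positivity
    rw [abs_le]
    constructor <;> linarith
  calc varDeviation h X y S w = m / q + D := rfl
    _ ≤ 1 / q + 2 * ((h.b₀ / d + h.a₀ + 1 + h.α / 2 * |rss X y S / w - n|) /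
          (postShape h n - 1)) := by linarith
    _ = _ := by ring

theorem lintegral_varDeviation_le {h : HyperParams} (hh : h.Admissible) {K : ℝ} (hK0 : 0 ≤ K)
    (hK : ∫⁻ z, ENNReal.ofReal |‖z‖ ^ 2 - n| ∂(stdGaussian (EuclideanSpace ℝ (Fin n))) ≤
      ENNReal.ofReal (K * √n))
    (X : Matrix (Fin n) (Fin p) ℝ) (β : EuclideanSpace ℝ (Fin p)) {σ d : ℝ} (hσ : 0 < σ)
    (hd : 0 < d) (hdσ : d ≤ σ ^ 2) (hS : IsUnit (gram X (support β)))
    (hshape : 3 ≤ postShape h n) :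
    ∫⁻ y, ENNReal.ofReal ((support β).card * varDeviation h X y (support β) (σ ^ 2))
        ∂(dataLaw X β σ) ≤
      ENNReal.ofReal ((support β).card * (1 / √(postShape h n - 2) +
        2 * (h.b₀ / d + h.a₀ + 1) / (postShape h n - 1) +
        h.α / (postShape h n - 1) * (K * √n + (support β).card))) := by
  have hα := hh.α_pos
  have ha := hh.a₀_pos
  have hb := hh.b₀_pos
  have hA1 : 0 < postShape h n - 1 := by linarith
  set s : ℝ := ((support β).card : ℝ) with hs
  have hs0 : 0 ≤ s := Nat.cast_nonneg _
  set c₁ := 1 / √(postShape h n - 2) + 2 * (h.b₀ / d + h.a₀ + 1) / (postShape h n - 1) with hc₁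
  have hc₁0 : 0 ≤ c₁ := by positivity
  set c₂ := h.α / (postShape h n - 1) with hc₂
  have hc₂0 : 0 ≤ c₂ := by positivity
  calc _ ≤ ∫⁻ y, (ENNReal.ofReal (s * c₁) + ENNReal.ofReal (s * c₂) *
          ENNReal.ofReal |rss X y (support β) / σ ^ 2 - n|) ∂(dataLaw X β σ) := by
        refine lintegral_mono fun y => ?_
        rw [← ENNReal.ofReal_mul (by positivity), ← ENNReal.ofReal_add (by positivity)
          (by positivity)]
        refine ENNReal.ofReal_le_ofReal ?_
        rw [mul_assoc, ← mul_add]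
        exact mul_le_mul_of_nonneg_left (varDeviation_le hh X y _ hd hdσ hshape) hs0
    _ = ENNReal.ofReal (s * c₁) + ENNReal.ofReal (s * c₂) *
          ∫⁻ y, ENNReal.ofReal |rss X y (support β) / σ ^ 2 - n| ∂(dataLaw X β σ) := by
        rw [lintegral_add_left measurable_const, lintegral_const, measure_univ, mul_one,
          lintegral_const_mul' _ _ ENNReal.ofReal_ne_top]
    _ ≤ ENNReal.ofReal (s * c₁) + ENNReal.ofReal (s * c₂) * ENNReal.ofReal (K * √n + s) := by
        gcongr
        exact lintegral_abs_rss_sub_le hK0 hK X β hσ hS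
    _ = _ := by
        rw [← ENNReal.ofReal_mul (by positivity), ← ENNReal.ofReal_add (by positivity)
          (by positivity)]
        congr 1
        ring

theorem eventually_three_le_postShape {h : HyperParams} (hh : h.Admissible) :
    ∀ᶠ n : ℕ in atTop, 3 ≤ postShape h n := by
  have hα := hh.α_pos
  have ha := hh.a₀_pos
  filter_upwards [tendsto_natCast_atTop_atTop.eventually_ge_atTop (6 / h.α)] with n hn
  rw [div_le_iff₀ hα] at hn
  unfold postShape
  linarith

theorem exists_rate_bound {h : HyperParams} (hh : h.Admissible) {C K : ℝ} (hC : 0 ≤ C)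
    (hK : 0 ≤ K) : ∃ M : ℝ, 0 < M ∧ ∀ᶠ n : ℕ in atTop, ∀ η s : ℝ, 0 ≤ s → η ≤ 1 →
      s ≤ η * (√(n : ℝ) / Real.log n) →
      s * (1 / √(postShape h n - 2) + C / (postShape h n - 1) +
        h.α / (postShape h n - 1) * (K * √n + s)) ≤ η * M := by
  have hα := hh.α_pos
  have ha := hh.a₀_pos
  refine ⟨2 / √h.α + 4 * C / h.α + 4 * (K + 1), by positivity, ?_⟩
  filter_upwards [tendsto_natCast_atTop_atTop.eventually_ge_atTop (8 / h.α),
    tendsto_natCast_atTop_atTop.eventually_ge_atTop (Real.exp 1)] with n hn hne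
  intro η s hs0 hη hs
  rw [div_le_iff₀ hα] at hn
  have hn1 : (1 : ℝ) ≤ n := (Real.one_le_exp zero_le_one).trans hne
  have hlog : 1 ≤ Real.log n := by
    rw [Real.le_log_iff_exp_le (by linarith)]
    exact hne
  have hr1 : 1 ≤ √(n : ℝ) := Real.one_le_sqrt.2 hn1
  have hrr : √(n : ℝ) ^ 2 = n := Real.sq_sqrt (by linarith)
  set r := √(n : ℝ) with hr
  have hr0 : 0 < r := by linarith
  have hη0 : 0 ≤ η := by
    by_contra hneg
    have : η * (r / Real.log n) < 0 := mul_neg_of_neg_of_pos (not_le.1 hneg) (by positivity)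
    linarith
  have hsr : s ≤ η * r := hs.trans (by gcongr; exact div_le_self hr0.le hlog)
  have hsr1 : s ≤ r := hsr.trans (by nlinarith)
  have hA : h.α / 4 * r ^ 2 ≤ postShape h n - 2 := by
    rw [hrr]; unfold postShape; linarith
  have hsq : √h.α / 2 * r ≤ √(postShape h n - 2) := by
    refine Real.le_sqrt_of_sq_le ?_
    rw [mul_pow, div_pow, Real.sq_sqrt hα.le]
    linarith
  have hpos : 0 < h.α / 4 * r ^ 2 := by positivity
  have h1 : 1 / √(postShape h n - 2) ≤ 1 / (√h.α / 2 * r) := by gcongr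
  have h2 : C / (postShape h n - 1) ≤ C / (h.α / 4 * r ^ 2) := by gcongr; linarith
  have h3 : h.α / (postShape h n - 1) * (K * r + s) ≤ h.α / (h.α / 4 * r ^ 2) * (K * r + r) := by
    gcongr
    linarith
  have h4 : C / (h.α / 4 * r ^ 2) ≤ C / (h.α / 4 * r) := by
    gcongr
    nlinarith
  have h5 : 0 < √h.α := Real.sqrt_pos.2 hα
  calc _ ≤ η * r * (1 / (√h.α / 2 * r) + C / (h.α / 4 * r) +
          h.α / (h.α / 4 * r ^ 2) * (K * r + r)) := by
        refine mul_le_mul hsr (by linarith) ?_ (by positivity)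
        have : 0 < postShape h n - 1 := by linarith
        positivity
    _ = _ := by
        field_simp

/-- The posterior and its normal approximation are close in total variation on average. -/
theorem exists_posterior_bound {h : HyperParams} (hh : h.Admissible)
    (p : ℕ → ℕ) (X : ∀ n : ℕ, Matrix (Fin n) (Fin (p n)) ℝ)
    (hX : ∀ (n : ℕ) (S : Finset (Fin (p n))), S.card ≤ (X n).rank → IsUnit (gram (X n) S))
    (σ₀ : ℕ → ℝ) (hσ₀ : ∀ n, 0 < σ₀ n) {d : ℝ} (hd₀ : 0 < d) (hd : ∀ n, d < σ₀ n ^ 2)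
    (B : ∀ n : ℕ, Set (EuclideanSpace ℝ (Fin (p n))))
    (hs : ∀ ε : ℝ, 0 < ε → ∀ᶠ n : ℕ in atTop, ∀ β ∈ B n,
      ((support β).card : ℝ) ≤ ε * (√(n : ℝ) / Real.log n))
    (hπ : ∀ ε : ℝ≥0∞, 0 < ε → ∀ᶠ n : ℕ in atTop, ∀ β ∈ B n,
      1 - ε ≤ ∫⁻ y, modelPosterior h (X n) y (support β) ∂(dataLaw (X n) β (σ₀ n)))
    {ε : ℝ≥0∞} (hε : 0 < ε) :
    ∀ᶠ n : ℕ in atTop, ∀ β ∈ B n, ∃ G : EuclideanSpace ℝ (Fin n) → ℝ≥0∞,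
      (∀ y A, MeasurableSet A → betaPosterior h (X n) y A ≤
        normalDirac (X n) y (support β) (σ₀ n ^ 2 / (h.α + h.γ)) A + G y) ∧
      ∫⁻ y, G y ∂(dataLaw (X n) β (σ₀ n)) ≤ ε := by
  have ha := hh.a₀_pos
  have hb := hh.b₀_pos
  set δ := min ε 1 / 2 with hδ
  have hδ0 : 0 < δ := ENNReal.half_pos (lt_min hε one_pos).ne'
  have hδ1 : δ ≤ 1 / 2 := ENNReal.div_le_div_right (min_le_right _ _) _
  have hδt : δ ≠ ∞ := (hδ1.trans_lt (by simp)).ne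
  have hδε : δ + δ ≤ ε := (ENNReal.add_halves _).trans_le (min_le_left _ _)
  have hδr : 0 < δ.toReal := ENNReal.toReal_pos hδ0.ne' hδt
  obtain ⟨K, hK0, hK⟩ := exists_lintegral_abs_norm_sq_sub_le
  obtain ⟨M, hM0, hM⟩ := exists_rate_bound hh (C := 2 * (h.b₀ / d + h.a₀ + 1)) (K := K)
    (by positivity) hK0
  have hη0 : 0 < min 1 (δ.toReal / M) := lt_min one_pos (by positivity)
  filter_upwards [hs _ hη0, hπ δ hδ0, hM, eventually_three_le_postShape hh,
    eventually_gt_atTop 0] with n hsn hπn hMn hshape hn β hβ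
  have hcard : (support β).card ≤ (X n).rank := by
    by_contra hlt
    have h0 := hπn β hβ
    simp only [modelPosterior, modelPrior_of_rank_lt h (X n) (not_le.1 hlt), ENNReal.ofReal_zero,
      zero_mul, ENNReal.zero_div, lintegral_zero, nonpos_iff_eq_zero, tsub_eq_zero_iff_le] at h0
    have := h0.trans hδ1
    norm_num at this
  have hS := hX n _ hcard
  have hmeas : Measurable fun y => ENNReal.ofReal
      ((support β).card * varDeviation h (X n) y (support β) (σ₀ n ^ 2)) := by
    have := measurable_rss (X n) (support β)
    unfold varDeviation postScale
    fun_prop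
  refine ⟨fun y => (1 - modelPosterior h (X n) y (support β)) + ENNReal.ofReal
      ((support β).card * varDeviation h (X n) y (support β) (σ₀ n ^ 2)), fun y A hA =>
    betaPosterior_le hh (X n) y (hX n) hcard (by linarith) (pow_pos (hσ₀ n) 2) hA, ?_⟩
  rw [lintegral_add_right _ hmeas]
  refine le_trans (add_le_add ?_ ?_) hδε
  · have h1 := le_lintegral_add (μ := dataLaw (X n) β (σ₀ n))
      (fun y => 1 - modelPosterior h (X n) y (support β))
      (fun y => modelPosterior h (X n) y (support β))
    simp only [tsub_add_cancel_of_le (modelPosterior_le_one hh (X n) _ (hX n) (support β)),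
      lintegral_const, measure_univ, mul_one] at h1
    have h2 : (1 - δ) + δ = 1 := tsub_add_cancel_of_le (hδ1.trans (by simp))
    have h3 : 1 - δ ≠ ∞ := by finiteness
    refine (ENNReal.add_le_add_iff_left h3).1 ?_
    rw [h2, add_comm]
    exact (add_le_add le_rfl (hπn β hβ)).trans h1
  · refine (lintegral_varDeviation_le hh hK0 (hK n hn) (X n) β (hσ₀ n) hd₀ (hd n).le hS
      hshape).trans ?_
    rw [← ENNReal.ofReal_toReal hδt]
    refine ENNReal.ofReal_le_ofReal ((hMn _ _ (Nat.cast_nonneg _) (min_le_left _ _)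
      (hsn β hβ)).trans ?_)
    calc min 1 (δ.toReal / M) * M ≤ δ.toReal / M * M := by gcongr; exact min_le_right _ _
      _ = δ.toReal := div_mul_cancel₀ _ hM0.ne'

end

end EmpiricalBayes

end

theorem theorem6
    (h : EmpiricalBayes.HyperParams) (hh : h.Admissible)
    (p : ℕ → ℕ) (X : ∀ n : ℕ, Matrix (Fin n) (Fin (p n)) ℝ)
    (hX : ∀ (n : ℕ) (S : Finset (Fin (p n))), S.card ≤ (X n).rank →
      IsUnit (EmpiricalBayes.gram (X n) S))
    (σ₀ : ℕ → ℝ) (hσ₀ : ∀ n, 0 < σ₀ n)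
    (d₁ d₂ : ℝ) (hd₁ : 0 < d₁) (hd : ∀ n, d₁ < σ₀ n ^ 2 ∧ σ₀ n ^ 2 < d₂)
    (B : ∀ n : ℕ, Set (EuclideanSpace ℝ (Fin (p n))))
    (hs : ∀ ε : ℝ, 0 < ε → ∀ᶠ n : ℕ in atTop, ∀ β ∈ B n,
      ((EmpiricalBayes.support β).card : ℝ) ≤ ε * (√(n : ℝ) / Real.log n))
    (hπ : ∀ ε : ℝ≥0∞, 0 < ε → ∀ᶠ n : ℕ in atTop, ∀ β ∈ B n,
      1 - ε ≤ ∫⁻ y, EmpiricalBayes.modelPosterior h (X n) y (EmpiricalBayes.support β)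
        ∂(EmpiricalBayes.dataLaw (X n) β (σ₀ n))) :
    (∀ ε : ℝ≥0∞, 0 < ε → ∀ᶠ n : ℕ in atTop, ∀ β ∈ B n,
      ∫⁻ y, EmpiricalBayes.hellingerSq (EmpiricalBayes.betaPosterior h (X n) y)
          (EmpiricalBayes.normalDirac (X n) y (EmpiricalBayes.support β)
            (σ₀ n ^ 2 / (h.α + h.γ)))
        ∂(EmpiricalBayes.dataLaw (X n) β (σ₀ n)) ≤ ε) ∧
    (∀ ε : ℝ≥0∞, 0 < ε → ∀ᶠ n : ℕ in atTop, ∀ β ∈ B n,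
      ∫⁻ y, EmpiricalBayes.tvDist (EmpiricalBayes.betaPosterior h (X n) y)
          (EmpiricalBayes.normalDirac (X n) y (EmpiricalBayes.support β)
            (σ₀ n ^ 2 / (h.α + h.γ)))
        ∂(EmpiricalBayes.dataLaw (X n) β (σ₀ n)) ≤ ε) := by
  refine ⟨fun ε hε => ?_, fun ε hε => ?_⟩
  · filter_upwards [EmpiricalBayes.exists_posterior_bound hh p X hX σ₀ hσ₀ hd₁ (fun n => (hd n).1)
      B hs hπ (ENNReal.half_pos hε.ne')] with n hn β hβ
    obtain ⟨G, hG, hint⟩ := hn β hβ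
    calc _ ≤ ∫⁻ y, 2 * G y ∂(EmpiricalBayes.dataLaw (X n) β (σ₀ n)) := by
          refine lintegral_mono fun y => ?_
          have := EmpiricalBayes.isProbabilityMeasure_betaPosterior hh (X n) y (hX n)
          exact EmpiricalBayes.hellingerSq_le (hG y)
      _ = 2 * ∫⁻ y, G y ∂(EmpiricalBayes.dataLaw (X n) β (σ₀ n)) :=
          lintegral_const_mul' _ _ ENNReal.ofNat_ne_top
      _ ≤ 2 * (ε / 2) := by gcongr
      _ = ε := ENNReal.mul_div_cancel two_ne_zero ENNReal.ofNat_ne_top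
  · filter_upwards [EmpiricalBayes.exists_posterior_bound hh p X hX σ₀ hσ₀ hd₁ (fun n => (hd n).1)
      B hs hπ hε] with n hn β hβ
    obtain ⟨G, hG, hint⟩ := hn β hβ
    refine (lintegral_mono fun y => ?_).trans hint
    have := EmpiricalBayes.isProbabilityMeasure_betaPosterior hh (X n) y (hX n)
    exact EmpiricalBayes.tvDist_le (hG y)
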